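/- **Transformer approximation rates.** There is an absolute constant $C\in\mathbb N$, $C\ge 1$, such that the following holds. Let $d,n,m\ge 1$ be integers, $\Omega=[0,1]^d$, $N=2dn+1$, and let $f:\Omega^n\to\mathbb R^n$ be $S_n$-equivariant, with modulus of continuity $$\omega(f,\epsilon)=\sup\{\|f(X)-f(Y)\|_\infty : X,Y\in\Omega^n,\ \|X-Y\|_\infty\le\epsilon\}\in[0,\infty].$$ Let $\mathcal N_r$ be the smallest number of $\ell_\infty$-balls of radius $r=\frac{1}{2m(2nd+1)}$ that cover $\Omega^n$ modulo the permutations in $S_n$ that fix one index. Then there are ReLU networks $\Phi:\mathbb R^d\to\mathbb R^N$ and $\rho:\mathbb R^{2N}\to\mathbb R$ such that * $\Phi$ has three hidden layers of width $2d(2dn+1)(m+1)$, then one hidden layer of width $(2dn+1)(m+1)^d$, and an output layer of width $2dn+1$; * $\rho$ has $C(m+1)^d$ hidden layers of width $C(n+1)(2dn+1)$, followed by $L$ hidden layers of width $12(2dn+1)$, where $$L\le C\max\Big\{\sqrt{\mathcal N_r\log[n(2m+1)\mathcal N_r]},\ \log(2nd+1)^2\Big\};$$ and a two-block Transformer $\mathcal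 T=\mathrm{Block}_2\circ\mathrm{Block}_1$ with token dimension $D=1+d+2N$, where $\mathrm{Block}_k(X)=X+FC_k(X+\mathrm{Att}_k(X))$, $FC_k$ acts on each row, $\mathrm{Att}_k(X)=[H_1(X),\dots,H_h(X)]W_O$ and each head is $H(X)=\mathrm{softmax}\big((XW_Q)(XW_K)^\top/\sqrt D\big)XW_V$ with row-wise softmax and $W_Q,W_K,W_V\in\mathbb R^{D\times D}$, with the following properties. Split $\mathbb R^D=\mathbb R\times\mathbb R^d\times\mathbb R^N\times\mathbb R^N$; the input $X=(x_1,\dots,x_n)\in\Omega^n$ is fed in with rows $(0,x_i,0,0)$, and $\mathcal T(X)_i$ denotes the first coordinate of the $i$-th output row. * $FC_1$ is $\Phi$ applied to the $\mathbb R^d$-part of a token, followed by one affine layer of width $2N+d+1$; $FC_2$ is $\rho$ applied to the last $2N$ coordinates of a token, followed by an affine map $\mathbb R\to\mathbb R^D$. * $\mathrm{Att}_2$ has a single head. For every $X\in\Omega^n$ all its attention weights equal $1/n$, and the last $2N$ coordinates of the $i$-th row of $X_1+\mathrm{Att}_2(X_1)$, $X_1=\mathrm{Block}_1(X)$, are $\big(\Phi(x_i),\sum_{j\ne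 i}\Phi(x_j)\big)$. * For every $X\in\Omega^n$ and $i\in\{1,\dots,n\}$, $$\mathcal T(X)_i=\rho\Big(\Phi(x_i),\sum_{j\ne i}\Phi(x_j)\Big),\qquad |f(X)_i-\mathcal T(X)_i|\le 2\,\omega\big(f,\tfrac1{2m}\big).$$ -/

import Mathlib

open scoped ENNReal Matrix

noncomputable section

/-- `IsReLUNet ws F`: the map `F` is computed by a fully connected ReLU network whose hidden layers
have, in order, the widths listed in `ws`; every hidden layer is an affine map followed by the
coordinatewise ReLU, and the output layer is affine. -/
def IsReLUNet {β : Type} : List ℕ → ∀ {α : Type} [Fintype α], ((α → ℝ) → β → ℝ) → Prop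
  | [], α, _, F => ∃ (W : Matrix β α ℝ) (b : β → ℝ), ∀ x, F x = W *ᵥ x + b
  | w :: ws, α, _, F =>
      ∃ (W : Matrix (Fin w) α ℝ) (b : Fin w → ℝ) (G : (Fin w → ℝ) → β → ℝ),
        IsReLUNet ws G ∧ ∀ x, F x = G (fun k => max 0 ((W *ᵥ x + b) k))

/-- Row-wise softmax. -/
def rowSoftmax {n : ℕ} (S : Matrix (Fin n) (Fin n) ℝ) : Matrix (Fin n) (Fin n) ℝ :=
  Matrix.of fun i j => Real.exp (S i j) / ∑ k, Real.exp (S i k)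

/-- The weights of a self-attention head on tokens with coordinates indexed by `ι`. -/
structure AttentionHead (ι : Type) where
  WQ : Matrix ι ι ℝ
  WK : Matrix ι ι ℝ
  WV : Matrix ι ι ℝ

/-- The attention matrix `softmax ((X W_Q) (X W_K)ᵀ / √D)`, where `D` is the token dimension. -/
def AttentionHead.weights {ι : Type} [Fintype ι] (H : AttentionHead ι) {n : ℕ}
    (X : Matrix (Fin n) ι ℝ) : Matrix (Fin n) (Fin n) ℝ :=
  rowSoftmax ((Real.sqrt (Fintype.card ι))⁻¹ • ((X * H.WQ) * (X * H.WK)ᵀ))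

def AttentionHead.apply {ι : Type} [Fintype ι] (H : AttentionHead ι) {n : ℕ}
    (X : Matrix (Fin n) ι ℝ) : Matrix (Fin n) ι ℝ :=
  H.weights X * (X * H.WV)

/-- A multi-head self-attention layer: finitely many heads and an output matrix
`W_O ∈ ℝ^{hD × D}`. -/
structure AttentionLayer (ι : Type) where
  numHeads : ℕ
  heads : Fin numHeads → AttentionHead ι
  WO : Matrix (Fin numHeads × ι) ι ℝ

/-- `[Head₁(X), …, Head_h(X)] W_O`. -/
def AttentionLayer.apply {ι : Type} [Fintype ι] (A : AttentionLayer ι) {n : ℕ}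
    (X : Matrix (Fin n) ι ℝ) : Matrix (Fin n) ι ℝ :=
  (Matrix.of fun i (p : Fin A.numHeads × ι) => (A.heads p.1).apply X i p.2) * A.WO

/-- A Transformer block: an attention layer and a feed-forward ReLU network acting on tokens. -/
structure TransformerBlock (ι : Type) [Fintype ι] where
  att : AttentionLayer ι
  FC : (ι → ℝ) → ι → ℝ
  isReLUNet_FC : ∃ ws : List ℕ, IsReLUNet ws FC

/-- `X + Att(X)`, the input of the feed-forward part. -/
def TransformerBlock.mid {ι : Type} [Fintype ι] (B : TransformerBlock ι) {n : ℕ}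
    (X : Matrix (Fin n) ι ℝ) : Matrix (Fin n) ι ℝ :=
  X + B.att.apply X

/-- `Block(X) = X + FC(X + Att(X))`, with `FC` applied to every row. -/
def TransformerBlock.apply {ι : Type} [Fintype ι] (B : TransformerBlock ι) {n : ℕ}
    (X : Matrix (Fin n) ι ℝ) : Matrix (Fin n) ι ℝ :=
  X + Matrix.of fun i => B.FC (B.mid X i)

/-- The Transformer network `Block_l ∘ ⋯ ∘ Block_1` of the list `[Block_1, …, Block_l]`. -/
def transformer {ι : Type} [Fintype ι] (Bs : List (TransformerBlock ι)) {n : ℕ}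
    (X : Matrix (Fin n) ι ℝ) : Matrix (Fin n) ι ℝ :=
  Bs.foldl (fun Y B => B.apply Y) X

/-- Modulus of continuity, with values in `[0, ∞]`. On `Fin n → Fin d → _` and on `Fin n → ℝ` the
distance is the one of the `ℓ_∞`-norm. -/
def modulusOfContinuity {E F : Type} [PseudoMetricSpace E] [PseudoMetricSpace F]
    (f : E → F) (ε : ℝ) : ℝ≥0∞ :=
  ⨆ (x : E) (y : E) (_ : dist x y ≤ ε), edist (f x) (f y)

/-- The smallest number of balls of radius `r` that cover `E^n` modulo a group `G` of permutations
of the `n` entries. -/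
def coveringNumberMod (E : Type) [PseudoMetricSpace E] {n : ℕ}
    (G : Subgroup (Equiv.Perm (Fin n))) (r : ℝ) : ℕ :=
  sInf {k | ∃ t : Finset (Fin n → E), t.card = k ∧
    ∀ X : Fin n → E, ∃ c ∈ t, ∃ σ ∈ G, X ∘ σ ∈ Metric.ball c r}

/-- The cube `[0,1]^d`. -/
abbrev Cube (d : ℕ) : Type := Fin d → Set.Icc (0 : ℝ) 1

/-- Coordinates of the tokens, split as `ℝ^{1+d+2N} = ℝ × ℝ^d × ℝ^N × ℝ^N`. -/
abbrev TokenIdx (d N : ℕ) : Type := Unit ⊕ Fin d ⊕ (Fin N ⊕ Fin N)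

def point {d : ℕ} (x : Cube d) : Fin d → ℝ := fun a => x a

/-- Zero padding `x_i ↦ (0, x_i, 0, 0)` of the rows of `X`. -/
def padTokens {d n : ℕ} (N : ℕ) (X : Fin n → Cube d) : Matrix (Fin n) (TokenIdx d N) ℝ :=
  Matrix.of fun i => Sum.elim 0 (Sum.elim (point (X i)) 0)

/-- The `ℝ^d` part of a token. -/
def pointPart {d N : ℕ} (z : TokenIdx d N → ℝ) : Fin d → ℝ := fun a => z (Sum.inr (Sum.inl a))

/-- The last `2N` coordinates of a token. -/
def lastPart {d N : ℕ} (z : TokenIdx d N → ℝ) : Fin N ⊕ Fin N → ℝ := fun a => z (Sum.inr (Sum.inr a))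

end

/-! Use `N = 2dn+1` grids of mesh `1/m`, shifted against one another, whose cells are separated by
gaps of width `1/(mN)`. Each of the `nd` coordinates of `X` falls into a gap of exactly one grid, so
at least `dn+1` grids, a strict majority, see all tokens inside cells. On such a grid, step
functions with steep ramps are exact, and `Φ` outputs `(n+1)^c` for the number `c` of the cell of
the token, one channel per grid (`exists_gridEncoder`, `card_avoidsGaps`).

The sum of these powers over `j ≠ i` is a number in base `n+1` whose digits are the occupation
counts of the cells; they are at most `n-1`, so nothing is carried. Thus in a good channel `ρ` sees
the cell of token `i` and the multiset of the other cells, which by equivariance is all that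
`f(·)_i` at the tuple of centres depends on. `ρ` reads the digits and turns them into a rank among
multisets (`decode_spec`, `compositionRank_inj`). With `M = (m+1)^d` this indexes the configurations
by the numbers below `P = M * M.multichoose (n-1)`, and `P` is at most the covering number, because
configurations of lattice points are separated modulo permutations
(`mul_multichoose_le_coveringNumberMod`).

Since `f` stays within `2mω` of its value at `0`, labels up to `8m` resolve it with step `ω/2`, and
bit extraction memorizes `P` labels of `T` bits in depth of order `√(PT)` (`exists_memorization`,
`exists_block_length`).

Bad channels may carry arbitrary values. A binary search by majority vote still returns a number
within one label of the range of the good labels (`vote_spec`). The error is at most `ω` for moving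
to the centres, `ω/2` for quantization and `ω/2` for the vote. The Transformer only forms the
leave-one-out sum, with uniform attention and the residual connection. -/

/-! ### Calculus of ReLU networks. -/

/-- Affine real-valued functions on a coordinate space. -/
def IsAffineForm {α : Type} [Fintype α] (φ : (α → ℝ) → ℝ) : Prop :=
  ∃ (w : α → ℝ) (c : ℝ), ∀ x, φ x = ∑ i, w i * x i + c

namespace IsAffineForm

variable {α : Type} [Fintype α] {φ ψ : (α → ℝ) → ℝ}

theorem const (c : ℝ) : IsAffineForm (fun _ : α → ℝ => c) := ⟨0, c, by simp⟩

theorem coord (i : α) : IsAffineForm (fun x : α → ℝ => x i) := by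
  classical
  exact ⟨Pi.single i 1, 0, fun x => by simp [Pi.single_apply]⟩

theorem add (hφ : IsAffineForm φ) (hψ : IsAffineForm ψ) : IsAffineForm (fun x => φ x + ψ x) := by
  obtain ⟨w, c, h⟩ := hφ
  obtain ⟨w', c', h'⟩ := hψ
  refine ⟨w + w', c + c', fun x => ?_⟩
  simp only [h, h', Pi.add_apply, add_mul, Finset.sum_add_distrib]
  ring

theorem const_mul (a : ℝ) (hφ : IsAffineForm φ) : IsAffineForm (fun x => a * φ x) := by
  obtain ⟨w, c, h⟩ := hφ
  refine ⟨a • w, a * c, fun x => ?_⟩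
  simp only [h, Pi.smul_apply, smul_eq_mul, mul_add, Finset.mul_sum, mul_assoc]

theorem sub (hφ : IsAffineForm φ) (hψ : IsAffineForm ψ) : IsAffineForm (fun x => φ x - ψ x) := by
  have h := hφ.add (hψ.const_mul (-1))
  simpa [sub_eq_add_neg] using h

theorem sum {ι : Type} (s : Finset ι) {φ : ι → (α → ℝ) → ℝ} (h : ∀ i ∈ s, IsAffineForm (φ i)) :
    IsAffineForm (fun x => ∑ i ∈ s, φ i x) := by
  classical
  induction s using Finset.induction_on with
  | empty => simpa using const 0
  | insert a s ha ih =>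
    simp only [Finset.sum_insert ha]
    exact (h a (by simp)).add (ih fun i hi => h i (by simp [hi]))

theorem comp {β : Type} [Fintype β] {F : (α → ℝ) → β → ℝ} {χ : (β → ℝ) → ℝ}
    (hχ : IsAffineForm χ) (hF : ∀ b, IsAffineForm fun x => F x b) :
    IsAffineForm (fun x => χ (F x)) := by
  obtain ⟨w, c, h⟩ := hχ
  simp only [h]
  exact (sum _ fun b _ => (hF b).const_mul _).add (const c)

end IsAffineForm

theorem isReLUNet_nil_iff {α β : Type} [Fintype α] {F : (α → ℝ) → β → ℝ} :
    IsReLUNet [] F ↔ ∀ b, IsAffineForm fun x => F x b := by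
  constructor
  · rintro ⟨W, b, h⟩ j
    exact ⟨W j, b j, fun x => by simp [h, Matrix.mulVec, dotProduct]⟩
  · intro h
    choose w c h using h
    exact ⟨w, c, fun x => funext fun j => by simp [h, Matrix.mulVec, dotProduct]⟩

theorem isReLUNet_cons_iff {α β : Type} [Fintype α] {F : (α → ℝ) → β → ℝ} {w : ℕ} {ws : List ℕ} :
    IsReLUNet (w :: ws) F ↔ ∃ (h : Fin w → (α → ℝ) → ℝ) (G : (Fin w → ℝ) → β → ℝ),
      (∀ k, IsAffineForm (h k)) ∧ IsReLUNet ws G ∧ ∀ x, F x = G fun k => max 0 (h k x) := by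
  constructor
  · rintro ⟨W, b, G, hG, h⟩
    exact ⟨fun k x => (W *ᵥ x + b) k, G,
      fun k => ⟨W k, b k, fun x => by simp [Matrix.mulVec, dotProduct]⟩, hG, h⟩
  · rintro ⟨h, G, hh, hG, hF⟩
    choose w c hw using hh
    refine ⟨w, c, G, hG, fun x => ?_⟩
    rw [hF]
    congr 1
    funext k
    rw [hw]
    simp [Matrix.mulVec, dotProduct]

namespace IsReLUNet

theorem comp_affine {α α' β : Type} [Fintype α] [Fintype α'] {ws : List ℕ}
    {F : (α → ℝ) → β → ℝ} (hF : IsReLUNet ws F) {A : (α' → ℝ) → α → ℝ}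
    (hA : ∀ a, IsAffineForm fun x => A x a) : IsReLUNet ws (fun x => F (A x)) := by
  cases ws with
  | nil =>
    rw [isReLUNet_nil_iff] at hF ⊢
    exact fun b => (hF b).comp hA
  | cons w ws =>
    rw [isReLUNet_cons_iff] at hF ⊢
    obtain ⟨h, G, hh, hG, hF⟩ := hF
    exact ⟨fun k x => h k (A x), G, fun k => (hh k).comp hA, hG, fun x => hF (A x)⟩

/-- The affine output layer of `F` merges with the first affine map of `G`, so composition costs no
extra layer. -/
theorem comp {α β γ : Type} [Fintype α] [Fintype β] {ws ws' : List ℕ}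
    {F : (α → ℝ) → β → ℝ} {G : (β → ℝ) → γ → ℝ} (hG : IsReLUNet ws' G) (hF : IsReLUNet ws F) :
    IsReLUNet (ws ++ ws') (fun x => G (F x)) := by
  induction ws generalizing α with
  | nil =>
    rw [isReLUNet_nil_iff] at hF
    exact hG.comp_affine hF
  | cons w ws ih =>
    rw [isReLUNet_cons_iff] at hF
    rw [List.cons_append, isReLUNet_cons_iff]
    obtain ⟨h, H, hh, hH, hF⟩ := hF
    exact ⟨h, fun y => G (H y), hh, ih hH, fun x => by rw [hF]⟩

/-- A hidden layer whose neurons are indexed by any type with at most `w` elements. -/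
theorem cons_of_card_le {α β κ : Type} [Fintype α] [Fintype κ] {w : ℕ} {ws : List ℕ}
    (hw : Fintype.card κ ≤ w) {h : κ → (α → ℝ) → ℝ} (hh : ∀ k, IsAffineForm (h k))
    {G : (κ → ℝ) → β → ℝ} (hG : IsReLUNet ws G) :
    IsReLUNet (w :: ws) (fun x => G fun k => max 0 (h k x)) := by
  classical
  obtain ⟨e⟩ : Nonempty (κ ↪ Fin w) := Function.Embedding.nonempty_of_card_le (by simpa using hw)
  rw [isReLUNet_cons_iff]
  refine ⟨fun j x => if hj : ∃ k, e k = j then h hj.choose x else 0, fun y => G fun k => y (e k),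
    fun j => ?_, hG.comp_affine fun k => .coord _, fun x => ?_⟩
  · by_cases hj : ∃ k, e k = j
    · simpa only [hj, dite_true] using hh _
    · simpa only [hj, dite_false] using .const 0
  · congr 1
    funext k
    have hj : ∃ k', e k' = e k := ⟨k, rfl⟩
    have h_eq : (if hj : ∃ k', e k' = e k then h hj.choose x else 0) = h k x := by
      rw [dif_pos hj, e.injective hj.choose_spec]
    exact (congrArg (max 0) h_eq).symm

/-- ReLU is idempotent: a second layer can copy the nonnegative activations of the first. This pads
a network to a prescribed depth. -/
theorem repeat_width {α β : Type} [Fintype α] {F : (α → ℝ) → β → ℝ} {w : ℕ} {ws : List ℕ}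
    (hF : IsReLUNet (w :: ws) F) : IsReLUNet (w :: w :: ws) F := by
  rw [isReLUNet_cons_iff] at hF
  obtain ⟨h, G, hh, hG, hF⟩ := hF
  rw [isReLUNet_cons_iff]
  refine ⟨h, fun y => G fun k => max 0 (y k), hh, ?_, fun x => by simp [hF]⟩
  exact cons_of_card_le (κ := Fin w) (by simp) (fun k => .coord k) hG

theorem replicate_mono {α β : Type} [Fintype α] {F : (α → ℝ) → β → ℝ} {w k l : ℕ}
    (hF : IsReLUNet (List.replicate k w) F) (hk : 0 < k) (hkl : k ≤ l) :
    IsReLUNet (List.replicate l w) F := by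
  induction l, hkl using Nat.le_induction with
  | base => exact hF
  | succ l hl ih =>
    obtain ⟨l, rfl⟩ : ∃ j, l = j + 1 := ⟨l - 1, by omega⟩
    exact ih.repeat_width

/-- Networks of the same shape run in parallel on separate inputs. -/
theorem parallel {ι α β : Type} [Fintype ι] [Fintype α] {ws : List ℕ}
    {F : ι → (α → ℝ) → β → ℝ} (hF : ∀ i, IsReLUNet ws (F i)) :
    IsReLUNet (ws.map (Fintype.card ι * ·))
      (fun (x : ι × α → ℝ) (p : ι × β) => F p.1 (fun a => x (p.1, a)) p.2) := by
  induction ws generalizing α with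
  | nil =>
    simp only [isReLUNet_nil_iff] at hF
    rw [List.map_nil, isReLUNet_nil_iff]
    exact fun p => (hF p.1 p.2).comp fun a => .coord _
  | cons w ws ih =>
    simp only [isReLUNet_cons_iff] at hF
    choose h G hh hG hF using hF
    simp only [hF]
    exact cons_of_card_le (κ := ι × Fin w)
      (h := fun p x => h p.1 p.2 fun a => x (p.1, a)) (by simp)
      (fun p => (hh p.1 p.2).comp fun a => .coord _) (ih hG)

end IsReLUNet

/-- `runDown F k = F 0 ∘ ⋯ ∘ F (k - 1)`. -/
def runDown {S : Type} (F : ℕ → S → S) : ℕ → S → S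
  | 0, x => x
  | k + 1, x => runDown F k (F k x)

/-- `runUp F k = F (k - 1) ∘ ⋯ ∘ F 0`. -/
def runUp {S : Type} (F : ℕ → S → S) : ℕ → S → S
  | 0, x => x
  | k + 1, x => F k (runUp F k x)

section Run

variable {α : Type} [Fintype α] {w l : ℕ} {F : ℕ → (α → ℝ) → α → ℝ}

theorem IsReLUNet.runDown (hF : ∀ k, IsReLUNet (List.replicate l w) (F k)) (k : ℕ) :
    IsReLUNet (List.replicate (k * l) w) (runDown F k) := by
  induction k with
  | zero =>
    rw [Nat.zero_mul, List.replicate_zero, isReLUNet_nil_iff]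
    exact fun b => .coord b
  | succ k ih =>
    rw [Nat.succ_mul, Nat.add_comm, List.replicate_add]
    exact ih.comp (hF k)

theorem IsReLUNet.runUp (hF : ∀ k, IsReLUNet (List.replicate l w) (F k)) (k : ℕ) :
    IsReLUNet (List.replicate (k * l) w) (runUp F k) := by
  induction k with
  | zero =>
    rw [Nat.zero_mul, List.replicate_zero, isReLUNet_nil_iff]
    exact fun b => .coord b
  | succ k ih =>
    rw [Nat.succ_mul, List.replicate_add]
    exact (hF k).comp ih

end Run

/-- Real-valued functions computed by one hidden ReLU layer with `k` neurons. -/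
def IsShallow {α : Type} [Fintype α] (k : ℕ) (φ : (α → ℝ) → ℝ) : Prop :=
  ∃ (h : Fin k → (α → ℝ) → ℝ) (c : Fin k → ℝ) (c₀ : ℝ),
    (∀ j, IsAffineForm (h j)) ∧ ∀ x, φ x = ∑ j, c j * max 0 (h j x) + c₀

namespace IsShallow

variable {α : Type} [Fintype α] {φ ψ : (α → ℝ) → ℝ} {k l : ℕ}

theorem const (c : ℝ) : IsShallow 0 (fun _ : α → ℝ => c) := ⟨Fin.elim0, Fin.elim0, c, by simp⟩

theorem relu (h : IsAffineForm φ) : IsShallow 1 (fun x => max 0 (φ x)) :=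
  ⟨fun _ => φ, 1, 0, fun _ => h, by simp⟩

theorem coord (i : α) : IsShallow 1 (fun x : α → ℝ => max 0 (x i)) := relu (.coord i)

theorem const_mul (a : ℝ) (hφ : IsShallow k φ) : IsShallow k (fun x => a * φ x) := by
  obtain ⟨h, c, c₀, hh, hφ⟩ := hφ
  refine ⟨h, a • c, a * c₀, hh, fun x => ?_⟩
  simp only [hφ, Pi.smul_apply, smul_eq_mul, mul_add, Finset.mul_sum, mul_assoc]

theorem add (hφ : IsShallow k φ) (hψ : IsShallow l ψ) :
    IsShallow (k + l) (fun x => φ x + ψ x) := by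
  obtain ⟨h, c, c₀, hh, hφ⟩ := hφ
  obtain ⟨h', c', c₀', hh', hψ⟩ := hψ
  refine ⟨Fin.append h h', Fin.append c c', c₀ + c₀', fun j => ?_, fun x => ?_⟩
  · refine Fin.addCases (fun i => ?_) (fun i => ?_) j
    · simpa using hh i
    · simpa using hh' i
  · simp only [hφ, hψ, Fin.sum_univ_add, Fin.append_left, Fin.append_right]
    ring

theorem sub (hφ : IsShallow k φ) (hψ : IsShallow l ψ) :
    IsShallow (k + l) (fun x => φ x - ψ x) := by
  have h := hφ.add (hψ.const_mul (-1))
  simpa [sub_eq_add_neg] using h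

theorem sum {ι : Type} (s : Finset ι) {φ : ι → (α → ℝ) → ℝ} (h : ∀ i ∈ s, IsShallow k (φ i)) :
    IsShallow (s.card * k) (fun x => ∑ i ∈ s, φ i x) := by
  classical
  induction s using Finset.induction_on with
  | empty => simpa using const (α := α) 0
  | insert a s ha ih =>
    simp only [Finset.sum_insert ha, Finset.card_insert_of_notMem ha, Nat.succ_mul]
    rw [Nat.add_comm]
    exact (h a (by simp)).add (ih fun i hi => h i (by simp [hi]))

end IsShallow

theorem IsReLUNet.of_isShallow {α β : Type} [Fintype α] [Fintype β] {F : (α → ℝ) → β → ℝ}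
    (k : β → ℕ) (hF : ∀ b, IsShallow (k b) fun x => F x b) {w : ℕ} (hw : ∑ b, k b ≤ w) :
    IsReLUNet [w] F := by
  choose h c c₀ hh hF using hF
  have key := IsReLUNet.cons_of_card_le (κ := Σ b, Fin (k b)) (w := w) (ws := []) (by simpa using hw)
    (h := fun p => h p.1 p.2) (fun p => hh p.1 p.2)
    (G := fun y b => ∑ j, c b j * y ⟨b, j⟩ + c₀ b)
    (isReLUNet_nil_iff.2 fun b =>
      (IsAffineForm.sum _ fun j _ => (IsAffineForm.coord _).const_mul _).add (.const _))
  convert key using 3 with x b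
  exact hF b x

/-! ### Integer comparisons by ramps. -/

/-- The piecewise linear step from `0` on `(-∞, -1]` to `1` on `[0, ∞)`. -/
noncomputable def ramp (y : ℝ) : ℝ := max 0 (y + 1) - max 0 y

theorem ramp_of_nonneg {y : ℝ} (h : 0 ≤ y) : ramp y = 1 := by
  rw [ramp, max_eq_right h, max_eq_right (by linarith)]; ring

theorem ramp_of_le {y : ℝ} (h : y ≤ -1) : ramp y = 0 := by
  rw [ramp, max_eq_left (by linarith), max_eq_left (by linarith)]; ring

theorem ramp_nonneg (y : ℝ) : 0 ≤ ramp y := by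
  rw [ramp, sub_nonneg]
  exact max_le_max le_rfl (by linarith)

theorem ramp_le_one (y : ℝ) : ramp y ≤ 1 := by
  rw [ramp, sub_le_iff_le_add]
  refine max_le (by linarith [le_max_left 0 y]) (by linarith [le_max_right 0 y])

theorem ramp_natCast_sub (a b : ℕ) : ramp ((a : ℝ) - b) = if b ≤ a then 1 else 0 := by
  split_ifs with h
  · exact ramp_of_nonneg (by simpa using h)
  · refine ramp_of_le ?_
    have : (a : ℝ) + 1 ≤ b := by exact_mod_cast (not_le.1 h)
    linarith

theorem IsShallow.ramp {α : Type} [Fintype α] {φ : (α → ℝ) → ℝ} (h : IsAffineForm φ) :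
    IsShallow 2 (fun x => ramp (φ x)) :=
  (IsShallow.relu (h.add (.const 1))).sub (IsShallow.relu h)

/-! ### Ranking of sequences with a given sum. -/

/-- The number of sequences that precede, in a suitable order, the sequence `a 0, …, a (k - 1)`
among the sequences of natural numbers of length `k` with the same sum. -/
def compositionRank (k : ℕ) (a : ℕ → ℕ) : ℕ :=
  ∑ i ∈ Finset.range k, ((i + 1).multichoose (∑ j ∈ Finset.range (i + 1), a j) -
    (i + 1).multichoose (∑ j ∈ Finset.range i, a j))

theorem Nat.multichoose_succ_mono (k : ℕ) : Monotone (k + 1).multichoose :=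
  monotone_nat_of_le_succ fun r => by rw [Nat.multichoose_succ_succ]; exact Nat.le_add_left _ _

theorem compositionRank_succ (k : ℕ) (a : ℕ → ℕ) :
    compositionRank (k + 1) a = compositionRank k a +
      ((k + 1).multichoose (∑ j ∈ Finset.range (k + 1), a j) -
        (k + 1).multichoose (∑ j ∈ Finset.range k, a j)) :=
  Finset.sum_range_succ _ _

theorem Nat.multichoose_succ_pred (k r : ℕ) :
    k.multichoose r + (if r = 0 then 0 else (k + 1).multichoose (r - 1)) =
      (k + 1).multichoose r := by
  cases r with
  | zero => simp
  | succ r => simp [Nat.multichoose_succ_succ]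

theorem compositionRank_lt (k : ℕ) (a : ℕ → ℕ) :
    compositionRank k a < k.multichoose (∑ j ∈ Finset.range k, a j) := by
  induction k with
  | zero => simp [compositionRank]
  | succ k ih =>
    rw [compositionRank_succ]
    have h1 := Nat.multichoose_succ_pred k (∑ j ∈ Finset.range k, a j)
    have h2 := Nat.multichoose_succ_mono k
      (show ∑ j ∈ Finset.range k, a j ≤ ∑ j ∈ Finset.range (k + 1), a j by
        rw [Finset.sum_range_succ]; exact Nat.le_add_right _ _)
    omega

/-- Let `S` be the common sum of length `k+1` and `s` the sum of the first `k` entries. The lower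
rank is below `k.multichoose s`, so by Pascal's rule the full rank lies in an interval ending,
exclusively, at `(k+1).multichoose S - (k+1).multichoose (s-1)` and starting at the same expression
with `s` for `s-1`. These intervals are disjoint, hence the rank determines `s`, then the last
entry, and induction does the rest. -/
theorem compositionRank_inj {k : ℕ} {a b : ℕ → ℕ}
    (hs : ∑ j ∈ Finset.range k, a j = ∑ j ∈ Finset.range k, b j)
    (h : compositionRank k a = compositionRank k b) : ∀ j < k, a j = b j := by
  induction k with
  | zero => simp
  | succ k ih =>
    have aux : ∀ a b : ℕ → ℕ,
        ∑ j ∈ Finset.range (k + 1), a j = ∑ j ∈ Finset.range (k + 1), b j →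
        compositionRank (k + 1) a = compositionRank (k + 1) b →
        ∑ j ∈ Finset.range k, b j ≤ ∑ j ∈ Finset.range k, a j := by
      intro a b hs h
      by_contra! hlt
      rw [compositionRank_succ, compositionRank_succ, hs] at h
      have h1 := Nat.multichoose_succ_pred k (∑ j ∈ Finset.range k, b j)
      rw [if_neg (by omega)] at h1
      have h2 := Nat.multichoose_succ_mono k
        (show ∑ j ∈ Finset.range k, a j ≤ ∑ j ∈ Finset.range k, b j - 1 by omega)
      have h3 := compositionRank_lt k b
      have h4 := Nat.multichoose_succ_mono k
        (show ∑ j ∈ Finset.range k, b j ≤ ∑ j ∈ Finset.range (k + 1), b j by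
          rw [Finset.sum_range_succ]; exact Nat.le_add_right _ _)
      omega
    have heq := le_antisymm (aux b a hs.symm h.symm) (aux a b hs h)
    have hk : a k = b k := by
      rw [Finset.sum_range_succ, Finset.sum_range_succ] at hs
      omega
    rw [compositionRank_succ, compositionRank_succ, hs, heq] at h
    intro j hj
    rcases Nat.lt_succ_iff_lt_or_eq.1 hj with hj | rfl
    · exact ih heq (by omega) j hj
    · exact hk

/-! ### Reading digits and computing the rank. -/

/-- The piecewise linear interpolation of the values `g 0, …, g n`, up to the constant `g 0`. -/
noncomputable def interpolant (n : ℕ) (g : ℕ → ℝ) (y : ℝ) : ℝ :=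
  ∑ t ∈ Finset.range n, (g (t + 1) - g t) * ramp (y - (t + 1 : ℕ))

theorem interpolant_natCast {n x : ℕ} (g : ℕ → ℝ) (hx : x ≤ n) :
    interpolant n g x = g x - g 0 := by
  simp only [interpolant, ramp_natCast_sub, mul_ite, mul_one, mul_zero]
  rw [← Finset.sum_filter, ← Finset.sum_range_sub]
  congr 1
  ext t
  simp only [Finset.mem_filter, Finset.mem_range]
  omega

theorem IsShallow.interpolant {α : Type} [Fintype α] {φ : (α → ℝ) → ℝ} (h : IsAffineForm φ)
    (n : ℕ) (g : ℕ → ℝ) : IsShallow (n * 2) (fun x => interpolant n g (φ x)) := by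
  have := IsShallow.sum (Finset.range n) (k := 2)
    (φ := fun t x => (g (t + 1) - g t) * _root_.ramp (φ x - ((t + 1 : ℕ) : ℝ)))
    fun t _ => (IsShallow.ramp (h.sub (.const _))).const_mul _
  rwa [Finset.card_range] at this

theorem sum_mul_pow_lt {B : ℕ} {a : ℕ → ℕ} (k : ℕ) (ha : ∀ j < k, a j < B) :
    ∑ j ∈ Finset.range k, a j * B ^ j < B ^ k := by
  induction k with
  | zero => simp
  | succ k ih =>
    rw [Finset.sum_range_succ, pow_succ']
    have h1 := ih fun j hj => ha j (by omega)
    have h2 := Nat.mul_le_mul_right (B ^ k) (ha k (by omega))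
    rw [Nat.succ_mul] at h2
    omega

/-- The digit `⌊y / b⌋` of a natural number `y` with `⌊y / b⌋ ≤ n`. -/
noncomputable def digitSum (n b : ℕ) (y : ℝ) : ℝ :=
  ∑ t ∈ Finset.range n, ramp (y - ((t + 1) * b : ℕ))

theorem digitSum_natCast {n b a s : ℕ} (hs : s < b) (ha : a ≤ n) :
    digitSum n b ((s + a * b : ℕ) : ℝ) = a := by
  simp only [digitSum, ramp_natCast_sub]
  rw [← Finset.sum_filter, Finset.sum_const, nsmul_eq_mul, mul_one]
  congr 1
  conv_rhs => rw [← Finset.card_range a]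
  congr 1
  ext t
  simp only [Finset.mem_filter, Finset.mem_range]
  constructor
  · rintro ⟨-, h⟩
    by_contra! hat
    have := Nat.mul_le_mul_right b hat
    rw [Nat.succ_mul] at h
    omega
  · intro h
    have := Nat.mul_le_mul_right b (Nat.succ_le_of_lt h)
    exact ⟨by omega, by rw [Nat.succ_eq_add_one] at this; exact this.trans (Nat.le_add_left _ _)⟩

theorem IsShallow.digitSum {α : Type} [Fintype α] {φ : (α → ℝ) → ℝ} (h : IsAffineForm φ)
    (n b : ℕ) : IsShallow (n * 2) (fun x => digitSum n b (φ x)) := by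
  have := IsShallow.sum (Finset.range n) (k := 2)
    (φ := fun t x => _root_.ramp (φ x - (((t + 1) * b : ℕ) : ℝ)))
    fun t _ => IsShallow.ramp (h.sub (.const _))
  rwa [Finset.card_range] at this

/-- Reads the `k`-th digit in base `n + 1` of the first coordinate, and tests whether the third one
is at least `(n + 1) ^ k`. -/
noncomputable def digitStep (n c k : ℕ) (x : Fin 4 → ℝ) : Fin 5 → ℝ :=
  ![max 0 (x 0) - (n + 1) ^ k * digitSum n ((n + 1) ^ k) (x 0),
    max 0 (x 1),
    max 0 (x 1) - digitSum n ((n + 1) ^ k) (x 0),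
    -- The third coordinate is `(n+1)^e`, with `e` the distinguished cell, until digit `e` is
    -- reached. The ramp fires exactly at `k = e`; it then erases this coordinate and adds `e * c`
    -- to the accumulator, without a multiplication of variables.
    max 0 (x 2) - (n + 1) ^ k * ramp (x 2 - (n + 1) ^ k),
    max 0 (x 3) + k * c * ramp (x 2 - (n + 1) ^ k)]

/-- Adds the contribution of the `k`-th digit to the rank. -/
noncomputable def rankStep (n k : ℕ) (x : Fin 5 → ℝ) : Fin 4 → ℝ :=
  ![max 0 (x 0),
    max 0 (x 2),
    max 0 (x 3),
    max 0 (x 4) + (interpolant n (fun t => (k + 1).multichoose t) (x 1) -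
      interpolant n (fun t => (k + 1).multichoose t) (x 2))]

theorem isReLUNet_digitStep {n c k w : ℕ} (hw : 4 * n + 9 ≤ w) :
    IsReLUNet [w] (digitStep n c k) := by
  refine .of_isShallow ![1 + n * 2, 1, 1 + n * 2, 1 + 2, 1 + 2] (fun b => ?_) ?_
  · have hd := IsShallow.digitSum (.coord (0 : Fin 4)) n ((n + 1) ^ k)
    have hr := IsShallow.ramp ((IsAffineForm.coord (2 : Fin 4)).sub (.const (((n : ℝ) + 1) ^ k)))
    fin_cases b
    · exact (IsShallow.coord 0).sub (hd.const_mul _)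
    · exact IsShallow.coord 1
    · exact (IsShallow.coord 1).sub hd
    · exact (IsShallow.coord 2).sub (hr.const_mul _)
    · exact (IsShallow.coord 3).add (hr.const_mul _)
  · simp [Fin.sum_univ_succ]
    omega

theorem isReLUNet_rankStep {n k w : ℕ} (hw : 4 * n + 9 ≤ w) : IsReLUNet [w] (rankStep n k) := by
  refine .of_isShallow ![1, 1, 1, 1 + (n * 2 + n * 2)] (fun b => ?_) ?_
  · fin_cases b
    · exact IsShallow.coord 0
    · exact IsShallow.coord 2
    · exact IsShallow.coord 3
    · exact (IsShallow.coord 4).add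
        ((IsShallow.interpolant (.coord 1) n _).sub (IsShallow.interpolant (.coord 2) n _))
  · simp [Fin.sum_univ_succ]
    omega

theorem isReLUNet_decode {n c w : ℕ} (hw : 4 * n + 9 ≤ w) (k : ℕ) :
    IsReLUNet (List.replicate (k * 2) w)
      (runDown (fun k x => rankStep n k (digitStep n c k x)) k) :=
  IsReLUNet.runDown (l := 2)
    (fun _ => (isReLUNet_rankStep hw).comp (isReLUNet_digitStep hw)) k

/-- The state from which the digits `a 0, …, a (k - 1)` and the position `e < k` are decoded. -/
noncomputable def decodeState (n k : ℕ) (a : ℕ → ℕ) (e acc : ℕ) : Fin 4 → ℝ :=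
  ![((∑ j ∈ Finset.range k, a j * (n + 1) ^ j : ℕ) : ℝ), ((∑ j ∈ Finset.range k, a j : ℕ) : ℝ),
    ((if e < k then (n + 1) ^ e else 0 : ℕ) : ℝ), (acc : ℝ)]

theorem decode_step {n c k : ℕ} {a : ℕ → ℕ} (hn : 0 < n) (ha : ∑ j ∈ Finset.range (k + 1), a j ≤ n)
    (e acc : ℕ) :
    rankStep n k (digitStep n c k (decodeState n (k + 1) a e acc)) =
      decodeState n k a e (acc + (if e = k then e * c else 0) +
        ((k + 1).multichoose (∑ j ∈ Finset.range (k + 1), a j) -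
        (k + 1).multichoose (∑ j ∈ Finset.range k, a j))) := by
  have hlt : ∀ j < k + 1, a j < n + 1 := fun j hj =>
    Nat.lt_succ_of_le ((Finset.single_le_sum (f := a) (fun _ _ => Nat.zero_le _)
      (Finset.mem_range.2 hj)).trans ha)
  have hdig : digitSum n ((n + 1) ^ k)
      ((∑ j ∈ Finset.range (k + 1), a j * (n + 1) ^ j : ℕ) : ℝ) = a k := by
    rw [Finset.sum_range_succ]
    exact digitSum_natCast (sum_mul_pow_lt k fun j hj => hlt j (by omega))
      (Nat.lt_succ_iff.1 (hlt k (by omega)))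
  have hramp : ramp (((if e < k + 1 then (n + 1) ^ e else 0 : ℕ) : ℝ) - ((n : ℝ) + 1) ^ k) =
      if e = k then 1 else 0 := by
    have := ramp_natCast_sub (if e < k + 1 then (n + 1) ^ e else 0) ((n + 1) ^ k)
    push_cast at this ⊢
    rw [this]
    refine if_congr ?_ rfl rfl
    constructor
    · intro h
      split_ifs at h with hek
      · by_contra hne
        exact absurd h (not_le.2 (Nat.pow_lt_pow_right (by omega) (by omega)))
      · simp at h
    · rintro rfl
      simp
  have hmono := Nat.multichoose_succ_mono k
    (show ∑ j ∈ Finset.range k, a j ≤ ∑ j ∈ Finset.range (k + 1), a j by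
      rw [Finset.sum_range_succ]; exact Nat.le_add_right _ _)
  have h_rank : digitStep n c k (decodeState n (k + 1) a e acc) =
      ![((∑ j ∈ Finset.range k, a j * (n + 1) ^ j : ℕ) : ℝ),
        ((∑ j ∈ Finset.range (k + 1), a j : ℕ) : ℝ),
        ((∑ j ∈ Finset.range k, a j : ℕ) : ℝ),
        ((if e < k then (n + 1) ^ e else 0 : ℕ) : ℝ),
        ((acc + (if e = k then e * c else 0) : ℕ) : ℝ)] := by
    funext i
    fin_cases i
    · change max 0 ((∑ j ∈ Finset.range (k + 1), a j * (n + 1) ^ j : ℕ) : ℝ) - _ * digitSum n _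
        ((∑ j ∈ Finset.range (k + 1), a j * (n + 1) ^ j : ℕ) : ℝ) = _
      rw [hdig, max_eq_right (Nat.cast_nonneg _), Finset.sum_range_succ]
      push_cast
      have h : ∀ s a b : ℝ, s + a * b - b * a = s := fun _ _ _ => by ring
      exact h _ _ _
    · exact max_eq_right (Nat.cast_nonneg _)
    · change max 0 ((∑ j ∈ Finset.range (k + 1), a j : ℕ) : ℝ) - digitSum n _
        ((∑ j ∈ Finset.range (k + 1), a j * (n + 1) ^ j : ℕ) : ℝ) = _
      rw [hdig, max_eq_right (Nat.cast_nonneg _), Finset.sum_range_succ]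
      push_cast
      simp
    · change max 0 ((if e < k + 1 then (n + 1) ^ e else 0 : ℕ) : ℝ) - _ *
        ramp (((if e < k + 1 then (n + 1) ^ e else 0 : ℕ) : ℝ) - ((n : ℝ) + 1) ^ k) = _
      rw [hramp, max_eq_right (Nat.cast_nonneg _)]
      rcases lt_trichotomy e k with h | rfl | h
      · simp [h, h.ne, h.trans (Nat.lt_succ_self k)]
      · simp
      · simp [h.ne', not_lt.2 h.le, show ¬ e < k + 1 by omega]
    · change max 0 (acc : ℝ) + _ * _ *
        ramp (((if e < k + 1 then (n + 1) ^ e else 0 : ℕ) : ℝ) - ((n : ℝ) + 1) ^ k) = _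
      rw [hramp, max_eq_right (Nat.cast_nonneg _)]
      change _ = ((acc + (if e = k then e * c else 0) : ℕ) : ℝ)
      by_cases h : e = k
      · simp [h]
      · simp [h]
  rw [h_rank]
  have hk : ∑ j ∈ Finset.range k, a j ≤ n :=
    (by rw [Finset.sum_range_succ]; exact Nat.le_add_right _ _ :
      ∑ j ∈ Finset.range k, a j ≤ ∑ j ∈ Finset.range (k + 1), a j).trans ha
  funext i
  fin_cases i
  · exact max_eq_right (Nat.cast_nonneg _)
  · exact max_eq_right (Nat.cast_nonneg _)
  · exact max_eq_right (Nat.cast_nonneg _)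
  · change max 0 ((acc + (if e = k then e * c else 0) : ℕ) : ℝ) +
      (interpolant n _ ((∑ j ∈ Finset.range (k + 1), a j : ℕ) : ℝ) -
      interpolant n _ ((∑ j ∈ Finset.range k, a j : ℕ) : ℝ)) = ((_ : ℕ) : ℝ)
    rw [interpolant_natCast _ ha, interpolant_natCast _ hk, max_eq_right (Nat.cast_nonneg _),
      Nat.cast_add (acc + _), Nat.cast_sub hmono]
    ring

/-- Digits are consumed from the top, and the differences of multichoose numbers sum to the rank.
For `c = M.multichoose (n-1)` and `acc = 0` the result is `cellIndex`. -/
theorem decode_spec {n c k : ℕ} {a : ℕ → ℕ} (hn : 0 < n) (ha : ∑ j ∈ Finset.range k, a j ≤ n)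
    (e acc : ℕ) :
    runDown (fun k x => rankStep n k (digitStep n c k x)) k (decodeState n k a e acc) 3 =
      ((acc + (if e < k then e * c else 0) + compositionRank k a : ℕ) : ℝ) := by
  induction k generalizing acc with
  | zero => simp [runDown, decodeState, compositionRank]
  | succ k ih =>
    have hk : ∑ j ∈ Finset.range k, a j ≤ n :=
      (by rw [Finset.sum_range_succ]; exact Nat.le_add_right _ _ :
        ∑ j ∈ Finset.range k, a j ≤ ∑ j ∈ Finset.range (k + 1), a j).trans ha
    rw [runDown, decode_step hn ha, ih hk, compositionRank_succ]
    congr 1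
    rcases lt_trichotomy e k with h | rfl | h
    · simp only [h, h.ne, h.trans (Nat.lt_succ_self k), if_true, if_false]
      ring
    · simp only [lt_irrefl, Nat.lt_succ_self, if_true, if_false]
      ring
    · simp only [h.ne', not_lt.2 h.le, show ¬ e < k + 1 by omega, if_false]
      ring

/-! ### Memorization by bit extraction. -/

/-- Passes to the next block of `b` consecutive numbers, with its code `code (j + 1)`, if the first
coordinate belongs to a block after the `j`-th one. -/
noncomputable def selectStep (code : ℕ → ℕ) (b j : ℕ) (x : Fin 3 → ℝ) : Fin 3 → ℝ :=
  ![max 0 (x 0),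
    max 0 (x 1) + ((code (j + 1) : ℝ) - code j) * ramp (x 0 - (((j + 1) * b : ℕ) : ℝ)),
    max 0 (x 2) - b * ramp (x 0 - (((j + 1) * b : ℕ) : ℝ))]

theorem isReLUNet_selectStep (code : ℕ → ℕ) (b j : ℕ) : IsReLUNet [12] (selectStep code b j) := by
  refine .of_isShallow ![1, 1 + 2, 1 + 2] (fun i => ?_) (by simp [Fin.sum_univ_succ])
  have hr := IsShallow.ramp
    ((IsAffineForm.coord (0 : Fin 3)).sub (.const (((j + 1) * b : ℕ) : ℝ)))
  fin_cases i
  · exact IsShallow.coord 0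
  · exact (IsShallow.coord 1).add (hr.const_mul _)
  · exact (IsShallow.coord 2).sub (hr.const_mul _)

/-- The increments of `code` telescope and stop at block `x / b`; the last coordinate becomes the
position of `x` inside its block. -/
theorem runUp_selectStep (code : ℕ → ℕ) {b : ℕ} (hb : 0 < b) (x K : ℕ) :
    runUp (selectStep code b) K ![(x : ℝ), (code 0 : ℝ), (x : ℝ)] =
      ![(x : ℝ), (code (min K (x / b)) : ℝ), ((x - min K (x / b) * b : ℕ) : ℝ)] := by
  induction K with
  | zero => simp [runUp]
  | succ K ih =>
    have hle : x / b * b ≤ x := Nat.div_mul_le_self x b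
    rw [runUp, ih]
    simp only [selectStep, Matrix.cons_val_zero, Matrix.cons_val_one, Matrix.cons_val,
      ramp_natCast_sub, max_eq_right (Nat.cast_nonneg (α := ℝ) _), ← Nat.le_div_iff_mul_le hb]
    by_cases h : K + 1 ≤ x / b
    · have h2 : (K + 1) * b ≤ x := (Nat.mul_le_mul_right b h).trans hle
      have h3 : K * b ≤ x := (Nat.mul_le_mul_right b (by omega)).trans h2
      rw [if_pos h, min_eq_left h, min_eq_left (by omega)]
      congr 2
      · ring
      · congr 1
        push_cast [Nat.cast_sub h2, Nat.cast_sub h3]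
        ring
    · rw [if_neg h, min_eq_right (by omega), min_eq_right (by omega)]
      simp

/-- Extracts the binary digit number `i` of the first coordinate, and tests whether the second
coordinate is `i / T`. -/
noncomputable def bitStep (T i : ℕ) (x : Fin 3 → ℝ) : Fin 4 → ℝ :=
  ![max 0 (x 0) - 2 ^ i * ramp (x 0 - 2 ^ i),
    max 0 (x 1),
    max 0 (x 2),
    ramp (x 0 - 2 ^ i) - (max 0 (x 1 - (i / T : ℕ)) + max 0 ((i / T : ℕ) - x 1))]

/-- Adds the tested digit, with its weight `2 ^ (i % T)`, to the label. -/
noncomputable def bitAddStep (T i : ℕ) (x : Fin 4 → ℝ) : Fin 3 → ℝ :=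
  ![max 0 (x 0), max 0 (x 1), max 0 (x 2) + 2 ^ (i % T) * max 0 (x 3)]

theorem isReLUNet_bitStep (T i : ℕ) : IsReLUNet [12] (bitStep T i) := by
  refine .of_isShallow ![1 + 2, 1, 1, 2 + (1 + 1)] (fun j => ?_) (by simp [Fin.sum_univ_succ])
  have hr := IsShallow.ramp ((IsAffineForm.coord (0 : Fin 3)).sub (.const ((2 : ℝ) ^ i)))
  fin_cases j
  · exact (IsShallow.coord 0).sub (hr.const_mul _)
  · exact IsShallow.coord 1
  · exact IsShallow.coord 2
  · exact hr.sub ((IsShallow.relu ((IsAffineForm.coord 1).sub (.const _))).add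
      (IsShallow.relu ((IsAffineForm.const _).sub (.coord 1))))

theorem isReLUNet_bitAddStep (T i : ℕ) : IsReLUNet [12] (bitAddStep T i) := by
  refine .of_isShallow ![1, 1, 1 + 1] (fun i => ?_) (by simp [Fin.sum_univ_succ])
  fin_cases i
  · exact IsShallow.coord 0
  · exact IsShallow.coord 1
  · exact (IsShallow.coord 2).add ((IsShallow.coord 3).const_mul _)

theorem isReLUNet_extract (T k : ℕ) : IsReLUNet (List.replicate (k * 2) 12)
    (runDown (fun i x => bitAddStep T i (bitStep T i x)) k) :=
  IsReLUNet.runDown (l := 2)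
    (fun _ => (isReLUNet_bitAddStep _ _).comp (isReLUNet_bitStep _ _)) k

theorem Nat.mod_two_pow_add_one_eq (x i : ℕ) :
    x % 2 ^ (i + 1) = x % 2 ^ i + 2 ^ i * (x.testBit i).toNat := by
  rw [Nat.mod_pow_succ, Nat.toNat_testBit]

theorem ramp_mod_two_pow (u i : ℕ) :
    ramp (((u % 2 ^ (i + 1) : ℕ) : ℝ) - 2 ^ i) = ((u.testBit i).toNat : ℝ) := by
  have h := ramp_natCast_sub (u % 2 ^ (i + 1)) (2 ^ i)
  push_cast at h ⊢
  rw [h]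
  have h1 := Nat.mod_two_pow_add_one_eq u i
  have h2 : u % 2 ^ i < 2 ^ i := Nat.mod_lt _ (by positivity)
  cases hb : u.testBit i
  · rw [if_neg]
    · simp
    · rw [hb] at h1
      simp at h1
      omega
  · rw [if_pos]
    · simp
    · rw [hb] at h1
      simp at h1
      omega

/-- The product of a bit with the test `l = i / T` is the ReLU of `bit - |l - i / T|`: when the
integers differ, the distance is at least `1` and kills the bit. -/
theorem bit_step (T i u l acc : ℕ) :
    bitAddStep T i (bitStep T i ![((u % 2 ^ (i + 1) : ℕ) : ℝ), (l : ℝ), (acc : ℝ)]) =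
      ![((u % 2 ^ i : ℕ) : ℝ), (l : ℝ),
        ((acc + if l = i / T then 2 ^ (i % T) * (u.testBit i).toNat else 0 : ℕ) : ℝ)] := by
  simp only [bitAddStep, bitStep, Matrix.cons_val_zero, Matrix.cons_val_one, Matrix.cons_val,
    ramp_mod_two_pow, max_eq_right (Nat.cast_nonneg (α := ℝ) _)]
  congr 2
  · rw [Nat.mod_two_pow_add_one_eq]
    push_cast
    rw [add_sub_cancel_right]
    exact max_eq_right (by positivity)
  congr 1
  by_cases h : l = i / T
  · simp [← h]
  · rw [if_neg h, max_eq_left]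
    · simp
    · have h1 : ((u.testBit i).toNat : ℝ) ≤ 1 := by exact_mod_cast Bool.toNat_le _
      rcases lt_or_gt_of_ne h with h | h
      · have : (l : ℝ) + 1 ≤ (i / T : ℕ) := by exact_mod_cast h
        have := le_max_left 0 ((l : ℝ) - (i / T : ℕ))
        have := le_max_right 0 (((i / T : ℕ) : ℝ) - l)
        linarith
      · have : ((i / T : ℕ) : ℝ) + 1 ≤ l := by exact_mod_cast h
        have := le_max_right 0 ((l : ℝ) - (i / T : ℕ))
        have := le_max_left 0 (((i / T : ℕ) : ℝ) - l)
        linarith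

theorem extract_spec (T k u l acc : ℕ) :
    runDown (fun i x => bitAddStep T i (bitStep T i x)) k
      ![((u % 2 ^ k : ℕ) : ℝ), (l : ℝ), (acc : ℝ)] 2 =
      ((acc + ∑ i ∈ Finset.range k,
        if l = i / T then 2 ^ (i % T) * (u.testBit i).toNat else 0 : ℕ) : ℝ) := by
  induction k generalizing acc with
  | zero => simp [runDown]
  | succ k ih =>
    rw [runDown, bit_step, ih, Finset.sum_range_succ]
    congr 1
    ring

theorem sum_two_pow_mul_testBit (v T : ℕ) :
    ∑ s ∈ Finset.range T, 2 ^ s * (v.testBit s).toNat = v % 2 ^ T := by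
  induction T with
  | zero => simp [Nat.mod_one]
  | succ T ih => rw [Finset.sum_range_succ, ih, Nat.mod_two_pow_add_one_eq]

theorem sum_block_bits {T : ℕ} (hT : 0 < T) (v : ℕ → ℕ) (b l : ℕ) :
    (∑ i ∈ Finset.range (b * T),
      if l = i / T then 2 ^ (i % T) * ((v (i / T)).testBit (i % T)).toNat else 0) =
      if l < b then v l % 2 ^ T else 0 := by
  induction b with
  | zero => simp
  | succ b ih =>
    rw [Nat.succ_mul, Finset.sum_range_add, ih]
    have h : ∀ s ∈ Finset.range T, (if l = (b * T + s) / T then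
        2 ^ ((b * T + s) % T) * ((v ((b * T + s) / T)).testBit ((b * T + s) % T)).toNat else 0) =
        if l = b then 2 ^ s * ((v b).testBit s).toNat else 0 := by
      intro s hs
      have hs := Finset.mem_range.1 hs
      rw [Nat.mul_comm b T, Nat.mul_add_div hT, Nat.div_eq_of_lt hs, Nat.mul_add_mod,
        Nat.mod_eq_of_lt hs, Nat.add_zero]
    rw [Finset.sum_congr rfl h]
    rcases lt_trichotomy l b with h | rfl | h
    · simp [h, h.ne, h.trans (Nat.lt_succ_self b)]
    · simp [sum_two_pow_mul_testBit]
    · simp [h.ne', not_lt.2 h.le, show ¬ l < b + 1 by omega]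

/-- Memorization of `T`-bit labels of the numbers below `P`, arranged in blocks of length `b`. -/
theorem exists_memorization (P T b : ℕ) (hT : 0 < T) (hb : 0 < b) (v : ℕ → ℕ)
    (hv : ∀ x < P, v x < 2 ^ T) :
    ∃ F : (Fin 1 → ℝ) → Fin 1 → ℝ, IsReLUNet (List.replicate (P / b + b * T * 2) 12) F ∧
      ∀ x < P, F (fun _ => (x : ℝ)) 0 = v x := by
  -- All `b` labels of block `j` are packed into one weight of `b * T` bits. Selecting the block
  -- costs `P / b` layers and unpacking it `2 * b * T`.
  have hcode : ∀ j, ∃ u < 2 ^ (b * T), ∀ i < b * T,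
      u.testBit i = (v (j * b + i / T)).testBit (i % T) := fun j =>
    ⟨Nat.ofBits fun i : Fin (b * T) => (v (j * b + i / T)).testBit (i % T),
      Nat.ofBits_lt_two_pow _, fun i hi => Nat.testBit_ofBits_lt _ i hi⟩
  choose code hlt hbit using hcode
  have h1 : IsReLUNet (List.replicate (P / b) 12) (runUp (selectStep code b) (P / b)) := by
    simpa using IsReLUNet.runUp (l := 1) (isReLUNet_selectStep code b) (P / b)
  have h2 := (isReLUNet_extract T (b * T)).comp_affine (A := fun y : Fin 3 → ℝ => ![y 1, y 2, 0])
    fun i => by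
      fin_cases i
      · exact .coord 1
      · exact .coord 2
      · exact .const 0
  have h3 := (h2.comp h1).comp_affine
    (A := fun x : Fin 1 → ℝ => ![x 0, (code 0 : ℝ), x 0]) fun i => by
      fin_cases i
      · exact .coord 0
      · exact .const _
      · exact .coord 0
  have h4 := (isReLUNet_nil_iff.2 fun _ => IsAffineForm.coord 2 :
    IsReLUNet [] fun (y : Fin 3 → ℝ) (_ : Fin 1) => y 2).comp h3
  refine ⟨_, by simpa only [List.append_nil, ← List.replicate_add] using h4, fun x hx => ?_⟩
  have hl : x - x / b * b = x % b := by
    have := Nat.div_add_mod' x b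
    omega
  have hmod : x % b < b := Nat.mod_lt _ hb
  beta_reduce
  rw [runUp_selectStep code hb, min_eq_right (Nat.div_le_div_right hx.le), hl]
  have key := extract_spec T (b * T) (code (x / b)) (x % b) 0
  rw [Nat.mod_eq_of_lt (hlt _), Nat.cast_zero, Nat.zero_add] at key
  refine key.trans ?_
  rw [Finset.sum_congr rfl fun i hi => by rw [hbit _ i (Finset.mem_range.1 hi)],
    sum_block_bits hT (fun l => v (x / b * b + l)), if_pos hmod, Nat.div_add_mod',
    Nat.mod_eq_of_lt (hv x hx)]

/-! ### Approximate median by binary search. -/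

section Vote

variable {ι : Type} [Fintype ι]

/-- Counts the values that are at least `a + 2 ^ k`, where `a` is the coordinate `none`. -/
noncomputable def countStep (k : ℕ) (y : Option ι → ℝ) : Option (Option ι) → ℝ
  | some (some q) => max 0 (y (some q))
  | some none => max 0 (y none)
  | none => ∑ q, ramp (y (some q) - (y none + 2 ^ k))

/-- Increases `a` by `2 ^ k` if more than `h` values have been counted. -/
noncomputable def voteStep (h k : ℕ) (y : Option (Option ι) → ℝ) : Option ι → ℝ
  | some q => max 0 (y (some (some q)))
  | none => max 0 (y (some none)) + 2 ^ k * ramp (y none - (h + 1))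

theorem isReLUNet_countStep {w : ℕ} (k : ℕ) (hw : 3 * Fintype.card ι + 3 ≤ w) :
    IsReLUNet [w] (countStep (ι := ι) k) := by
  refine .of_isShallow (fun | some _ => 1 | none => Fintype.card ι * 2) (fun b => ?_) ?_
  · match b with
    | some (some q) => exact IsShallow.coord _
    | some none => exact IsShallow.coord _
    | none =>
      exact IsShallow.sum (α := Option ι) Finset.univ (k := 2)
        (φ := fun q y => ramp (y (some q) - (y none + 2 ^ k)))
        fun q _ => .ramp ((IsAffineForm.coord _).sub ((IsAffineForm.coord _).add (.const _)))
  · simp [Fintype.sum_option]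
    omega

theorem isReLUNet_voteStep {w : ℕ} (h k : ℕ) (hw : 3 * Fintype.card ι + 3 ≤ w) :
    IsReLUNet [w] (voteStep (ι := ι) h k) := by
  refine .of_isShallow (fun | some _ => 1 | none => 1 + 2) (fun b => ?_) ?_
  · match b with
    | some q => exact IsShallow.coord _
    | none =>
      exact (IsShallow.coord _).add
        ((IsShallow.ramp ((IsAffineForm.coord _).sub (.const _))).const_mul _)
  · simp [Fintype.sum_option]
    omega

/-- Binary search with the invariant `lo - 2^k < a < hi + 1`. If the threshold `a + 2^k` is at least
`hi + 1`, only the at most `h` channels outside `G` can count, and `a` stays. If it is at most `lo`,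
all of `G` counts, and `a` moves by the full `2^k`. Otherwise any partial move in `[0, 2^k]` is
harmless, so the ramps need not be exact there, nor the bad values integers. -/
theorem vote_spec {h : ℕ} (G : Finset ι) (hG : h < G.card) (hcard : Fintype.card ι ≤ h + G.card)
    {lab : ι → ℕ} {lo hi : ℕ} (hlo : ∀ q ∈ G, lo ≤ lab q) (hhi : ∀ q ∈ G, lab q ≤ hi)
    (k : ℕ) (y : Option ι → ℝ) (hy : ∀ q ∈ G, y (some q) = lab q) (h0 : 0 ≤ y none)
    (hup : y none < hi + 1) (hdown : lo < y none + 2 ^ k) :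
    (lo : ℝ) - 1 < runDown (fun k y => voteStep h k (countStep k y)) k y none ∧
      runDown (fun k y => voteStep h k (countStep k y)) k y none < (hi : ℝ) + 1 := by
  classical
  induction k generalizing y with
  | zero =>
    rw [pow_zero] at hdown
    exact ⟨by simpa [runDown, sub_lt_iff_lt_add] using hdown, hup⟩
  | succ k ih =>
    have hpow : (0 : ℝ) < 2 ^ k := by positivity
    rw [pow_succ] at hdown
    set cnt : ℝ := ∑ q, ramp (y (some q) - (y none + 2 ^ k)) with hcnt
    have hsplit : cnt = ∑ q ∈ G, ramp (y (some q) - (y none + 2 ^ k)) +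
        ∑ q ∈ Gᶜ, ramp (y (some q) - (y none + 2 ^ k)) := (Finset.sum_add_sum_compl G _).symm
    have hnone : voteStep h k (countStep k y) none = y none + 2 ^ k * ramp (cnt - (h + 1)) := by
      simp [voteStep, countStep, h0, hcnt]
    have hβ0 := ramp_nonneg (cnt - (h + 1))
    have hβ1 := ramp_le_one (cnt - (h + 1))
    refine ih _ (fun q hq => ?_) ?_ ?_ ?_
    · simp [voteStep, countStep, hy q hq]
    · beta_reduce
      rw [hnone]
      positivity
    · beta_reduce
      rw [hnone]
      by_cases ht : (hi : ℝ) + 1 ≤ y none + 2 ^ k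
      · have hG0 : ∑ q ∈ G, ramp (y (some q) - (y none + 2 ^ k)) = 0 :=
          Finset.sum_eq_zero fun q hq => ramp_of_le (by
            have : (lab q : ℝ) ≤ hi := by exact_mod_cast hhi q hq
            rw [hy q hq]
            linarith)
        have hc : ∑ q ∈ Gᶜ, ramp (y (some q) - (y none + 2 ^ k)) ≤ h := by
          refine (Finset.sum_le_card_nsmul _ _ 1 fun q _ => ramp_le_one _).trans ?_
          rw [nsmul_eq_mul, mul_one, Finset.card_compl]
          exact_mod_cast (by omega : Fintype.card ι - G.card ≤ h)
        rw [ramp_of_le (by linarith)]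
        simpa using hup
      · nlinarith
    · beta_reduce
      rw [hnone]
      by_cases ht : y none + 2 ^ k ≤ lo
      · have hG1 : ∑ q ∈ G, ramp (y (some q) - (y none + 2 ^ k)) = G.card := by
          rw [Finset.sum_congr rfl fun q hq => ramp_of_nonneg (by
            have : (lo : ℝ) ≤ lab q := by exact_mod_cast hlo q hq
            rw [hy q hq]
            linarith)]
          simp
        have hc : 0 ≤ ∑ q ∈ Gᶜ, ramp (y (some q) - (y none + 2 ^ k)) :=
          Finset.sum_nonneg fun q _ => ramp_nonneg _
        have hGh : (h : ℝ) + 1 ≤ G.card := by exact_mod_cast hG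
        rw [ramp_of_nonneg (by linarith)]
        linarith
      · nlinarith

/-- A network that approximates the median: its value is within distance less than `1` of the range
of the labels of every strict majority `G`. -/
theorem exists_vote (h T w : ℕ) (hcard : Fintype.card ι = 2 * h + 1)
    (hw : 3 * Fintype.card ι + 3 ≤ w) :
    ∃ F : (ι → ℝ) → Fin 1 → ℝ, IsReLUNet (List.replicate (T * 2) w) F ∧
      ∀ (G : Finset ι) (y : ι → ℝ) (lab : ι → ℕ) (lo hi : ℕ), h < G.card →
        (∀ q ∈ G, y q = lab q ∧ lo ≤ lab q ∧ lab q ≤ hi) → lo < 2 ^ T →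
        (lo : ℝ) - 1 < F y 0 ∧ F y 0 < (hi : ℝ) + 1 := by
  have h1 : IsReLUNet (List.replicate (T * 2) w)
      (runDown (fun k (y : Option ι → ℝ) => voteStep h k (countStep k y)) T) :=
    IsReLUNet.runDown (l := 2)
      (fun k => (isReLUNet_voteStep h k hw).comp (isReLUNet_countStep k hw)) T
  have h2 := h1.comp_affine (A := fun (y : ι → ℝ) (o : Option ι) => o.elim 0 y) fun o => by
    cases o with
    | none => exact .const 0
    | some q => exact .coord q
  have h3 := (isReLUNet_nil_iff.2 fun _ => IsAffineForm.coord none :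
    IsReLUNet [] fun (y : Option ι → ℝ) (_ : Fin 1) => y none).comp h2
  refine ⟨_, by simpa only [List.append_nil] using h3, fun G y lab lo hi hG hy hlo => ?_⟩
  refine vote_spec G hG (by omega) (fun q hq => (hy q hq).2.1) (fun q hq => (hy q hq).2.2) T _
    (fun q hq => (hy q hq).1) le_rfl ?_ ?_
  · change (0 : ℝ) < _
    positivity
  · change (lo : ℝ) < 0 + 2 ^ T
    rw [zero_add]
    exact_mod_cast hlo

end Vote

/-! ### Shifted grids and the encoder. -/

/-- The point `x` of `[0, 1]` avoids the gaps of the `q`-th of `N` shifted grids of mesh `1 / m`. -/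
def AvoidsGaps (N m q : ℕ) (x : ℝ) : Prop := ⌊m * N * x⌋₊ % N ≠ q

noncomputable instance (N m q : ℕ) (x : ℝ) : Decidable (AvoidsGaps N m q x) :=
  inferInstanceAs (Decidable (⌊m * N * x⌋₊ % N ≠ q))

/-- The cell of the `q`-th shifted grid that contains `x`. -/
noncomputable def gridCell (N m q : ℕ) (x : ℝ) : ℕ := (⌊m * N * x⌋₊ + (N - q - 1)) / N

section Grid

variable {N m q : ℕ} {x : ℝ}

theorem gridCell_le (hq : q < N) (hx : x ≤ 1) : gridCell N m q x ≤ m := by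
  rw [gridCell, ← Nat.lt_succ_iff, Nat.div_lt_iff_lt_mul (by omega)]
  have : ⌊m * N * x⌋₊ ≤ m * N := by
    refine Nat.floor_le_of_le ?_
    push_cast
    exact mul_le_of_le_one_right (by positivity) hx
  rw [Nat.succ_mul]
  omega

/-- In the scaled variable `m * N * x` the sloped part of the ramp is a unit interval on which the
floor is congruent to `q` modulo `N`, that is, a gap of the grid. Outside the gaps the ramp is an
exact step. -/
theorem ramp_grid (hq : q < N) (hx : 0 ≤ x) (h : AvoidsGaps N m q x) (k : ℕ) :
    ramp (m * N * x + (N - q - 1 : ℕ) - k * N) = if k ≤ gridCell N m q x then 1 else 0 := by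
  have hy : 0 ≤ m * N * x := by positivity
  have h1 := Nat.floor_le hy
  have h2 := Nat.lt_floor_add_one (m * N * x)
  simp only [gridCell, Nat.le_div_iff_mul_le (show 0 < N by omega)]
  rw [AvoidsGaps] at h
  set t := ⌊m * N * x⌋₊
  split_ifs with hk
  · have : (k : ℝ) * N ≤ t + (N - q - 1 : ℕ) := by exact_mod_cast hk
    exact ramp_of_nonneg (by linarith)
  · have hne : t + N ≠ q + k * N := fun heq => h (by
      rw [← Nat.add_mod_right, heq, Nat.add_mul_mod_self_right, Nat.mod_eq_of_lt hq])
    have : ((t + 1 + (N - q - 1) + 1 : ℕ) : ℝ) ≤ (k * N : ℕ) := by exact_mod_cast (by omega)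
    push_cast at this
    exact ramp_of_le (by linarith)

/-- The centre of a cell, projected to `[0, 1]`. -/
noncomputable def gridCenter (N m q k : ℕ) : Set.Icc (0 : ℝ) 1 :=
  Set.projIcc 0 1 zero_le_one ((k * N + q + 1 / 2 - N / 2) / (m * N))

/-- In the scaled variable, cell `k` without its gap runs from `(k-1)N + q + 1` to `kN + q`, with
midpoint `kN + q + 1/2 - N/2`. Projecting this midpoint to `[0, 1]` does not increase its distance
to `x`. -/
theorem dist_gridCenter_le (hq : q < N) (hm : 0 < m) (x : Set.Icc (0 : ℝ) 1)
    (h : AvoidsGaps N m q x) : dist x (gridCenter N m q (gridCell N m q x)) ≤ 1 / (2 * m) := by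
  have hy : 0 ≤ m * N * (x : ℝ) := mul_nonneg (by positivity) x.2.1
  have h1 := Nat.floor_le hy
  have h2 := Nat.lt_floor_add_one (m * N * (x : ℝ))
  have h3 := Nat.div_mul_le_self (⌊m * N * (x : ℝ)⌋₊ + (N - q - 1)) N
  have h4 := Nat.lt_div_mul_add (a := ⌊m * N * (x : ℝ)⌋₊ + (N - q - 1)) (show 0 < N by omega)
  change gridCell N m q x * N ≤ _ at h3
  change _ < gridCell N m q x * N + N at h4
  rw [AvoidsGaps] at h
  set t := ⌊m * N * (x : ℝ)⌋₊
  set k := gridCell N m q x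
  have hne : t + N ≠ q + (k + 1) * N := fun heq => h (by
    rw [← Nat.add_mod_right, heq, Nat.add_mul_mod_self_right, Nat.mod_eq_of_lt hq])
  rw [Nat.succ_mul] at hne
  have h5 : ((k * N + q + 1 : ℕ) : ℝ) ≤ (t + N : ℕ) := by exact_mod_cast (by omega)
  have h6 : ((t + 1 : ℕ) : ℝ) ≤ (k * N + q : ℕ) := by exact_mod_cast (by omega)
  push_cast at h5 h6
  have hN : (0 : ℝ) < N := by exact_mod_cast (by omega : 0 < N)
  have hm' : (0 : ℝ) < m := by exact_mod_cast hm
  have hproj : x = Set.projIcc (0 : ℝ) 1 zero_le_one x := (Set.projIcc_val _ x).symm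
  have hle : dist x (gridCenter N m q k) ≤
      |(x : ℝ) - (k * N + q + 1 / 2 - N / 2) / (m * N)| := by
    conv_lhs => rw [hproj]
    exact (Set.abs_projIcc_sub_projIcc zero_le_one)
  refine hle.trans ?_
  have heq : (x : ℝ) - (k * N + q + 1 / 2 - N / 2) / (m * N) =
      (m * N * x - (k * N + q + 1 / 2 - N / 2)) / (m * N) := by
    field_simp
  rw [heq, abs_div, abs_of_pos (by positivity : (0 : ℝ) < m * N), div_le_div_iff₀ (by positivity)
    (by positivity), one_mul]
  have habs : |m * N * (x : ℝ) - (k * N + q + 1 / 2 - N / 2)| ≤ N / 2 := by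
    rw [abs_le]
    constructor <;> linarith
  calc _ ≤ (N : ℝ) / 2 * (2 * m) := by gcongr
    _ = m * N := by ring

end Grid

/-- A coordinate lies in the gaps of just one grid, the one given by the residue of its scaled
floor; so at most `n * d` grids are spoiled. -/
theorem card_avoidsGaps {N d n : ℕ} (hN : 0 < N) (m : ℕ) (X : Fin n → Fin d → ℝ) :
    N ≤ n * d + (Finset.univ.filter fun q : Fin N => ∀ j a, AvoidsGaps N m q (X j a)).card := by
  classical
  have h1 := Finset.card_filter_add_card_filter_not
    (s := (Finset.univ : Finset (Fin N))) fun q : Fin N => ∀ j a, AvoidsGaps N m q (X j a)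
  have h2 : (Finset.univ.filter fun q : Fin N => ¬ ∀ j a, AvoidsGaps N m q (X j a)).card ≤
      n * d := by
    have hsub : (Finset.univ.filter fun q : Fin N => ¬ ∀ j a, AvoidsGaps N m q (X j a)) ⊆
        Finset.univ.image fun p : Fin n × Fin d =>
          (⟨⌊m * N * X p.1 p.2⌋₊ % N, Nat.mod_lt _ hN⟩ : Fin N) := by
      intro q hq
      simp only [Finset.mem_filter, Finset.mem_univ, true_and, not_forall, AvoidsGaps,
        not_not] at hq
      obtain ⟨j, a, h⟩ := hq
      exact Finset.mem_image.2 ⟨(j, a), Finset.mem_univ _, Fin.ext h⟩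
    refine (Finset.card_le_card hsub).trans (Finset.card_image_le.trans ?_)
    simp
  rw [Finset.card_univ, Fintype.card_fin] at h1
  omega

/-- The cell of the `q`-th shifted grid that contains the point `x` of the cube. -/
noncomputable def cubeCell {d : ℕ} {N : ℕ} (m : ℕ) (q : Fin N) (x : Cube d) : Fin d → Fin (m + 1) :=
  fun a => ⟨gridCell N m q (x a), Nat.lt_succ_of_le (gridCell_le q.2 (x a).2.2)⟩

/-- A network that computes, for each of `N` shifted grids, a given function of the cell. -/
theorem exists_gridEncoder (d N m : ℕ) (val : (Fin d → Fin (m + 1)) → ℝ) :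
    ∃ Φ : (Fin d → ℝ) → Fin N → ℝ,
      IsReLUNet [2 * d * N * (m + 1), 2 * d * N * (m + 1), 2 * d * N * (m + 1),
        N * (m + 1) ^ d] Φ ∧
      ∀ (x : Cube d) (q : Fin N), (∀ a, AvoidsGaps N m q (x a)) →
        Φ (point x) q = val (cubeCell m q x) := by
  classical
  let S : (Fin d → ℝ) → Fin N × Fin d × Fin (m + 1) → ℝ := fun x p =>
    ramp (m * N * x p.2.1 + (N - p.1 - 1 : ℕ) - (p.2.2 : ℕ) * N)
  have hS : IsReLUNet [2 * d * N * (m + 1)] S := by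
    refine .of_isShallow (fun _ => 2) (fun p => .ramp ?_) ?_
    · exact (((IsAffineForm.coord _).const_mul _).add (.const _)).sub (.const _)
    · simp only [Finset.sum_const, Finset.card_univ, Fintype.card_prod, Fintype.card_fin,
        smul_eq_mul]
      exact le_of_eq (by ring)
  -- The difference of consecutive steps is the indicator of cell `k`; the step beyond the last cell
  -- is set to `0`.
  let succ : (Fin N × Fin d × Fin (m + 1) → ℝ) → Fin N → Fin d → Fin (m + 1) → ℝ :=
    fun y q a k => if h : (k : ℕ) + 1 < m + 1 then y (q, a, ⟨k + 1, h⟩) else 0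
  have hsucc : ∀ q a k, IsAffineForm fun y => succ y q a k := by
    intro q a k
    by_cases h : (k : ℕ) + 1 < m + 1
    · simp only [succ, h, dite_true]
      exact .coord _
    · simp only [succ, h, dite_false]
      exact .const 0
  -- The product of the `d` indicators is the ReLU of `1` plus the sum of the `indicator - 1`.
  have hD : IsReLUNet [N * (m + 1) ^ d] fun (y : Fin N × Fin d × Fin (m + 1) → ℝ) (q : Fin N) =>
      ∑ κ : Fin d → Fin (m + 1), val κ *
        max 0 (1 + ∑ a, (y (q, a, κ a) - succ y q a (κ a) - 1)) := by
    refine .of_isShallow (fun _ => (Finset.univ : Finset (Fin d → Fin (m + 1))).card * 1)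
      (fun q => .sum Finset.univ fun κ _ => .const_mul _ (.relu ?_)) ?_
    · exact (IsAffineForm.const 1).add
        (.sum _ fun a _ => ((IsAffineForm.coord _).sub (hsucc _ _ _)).sub (.const 1))
    · simp
  refine ⟨_, (hD.comp hS).repeat_width.repeat_width, fun x q hx => ?_⟩
  have hstep : ∀ (a : Fin d) (k : ℕ),
      ramp (m * N * point x a + (N - q - 1 : ℕ) - k * N) =
        if k ≤ cubeCell m q x a then 1 else 0 :=
    fun a k => ramp_grid q.2 (x a).2.1 (hx a) k
  have hsucc' : ∀ a k, succ (S (point x)) q a k =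
      if (k : ℕ) + 1 ≤ cubeCell m q x a then 1 else 0 := by
    intro a k
    by_cases h : (k : ℕ) + 1 < m + 1
    · simp only [succ, h, dite_true]
      exact hstep a (k + 1)
    · have := (cubeCell m q x a).2
      simp only [succ, h, dite_false]
      rw [if_neg (by omega)]
  have hterm : ∀ a (k : Fin (m + 1)), S (point x) (q, a, k) - succ (S (point x)) q a k - 1 =
      if k = cubeCell m q x a then 0 else -1 := by
    intro a k
    rw [hsucc', show S (point x) (q, a, k) = _ from hstep a k]
    rcases lt_trichotomy k (cubeCell m q x a) with h | h | h
    · rw [if_pos (by exact_mod_cast h.le), if_pos (by exact_mod_cast h), if_neg h.ne]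
      ring
    · rw [h, if_pos le_rfl, if_neg (by omega), if_pos rfl]
      ring
    · rw [if_neg (by exact_mod_cast not_le.2 h), if_neg (fun h' => by
        have : (cubeCell m q x a : ℕ) < k := by exact_mod_cast h
        omega), if_neg h.ne']
      ring
  simp only [hterm]
  rw [Finset.sum_eq_single (cubeCell m q x)]
  · simp
  · intro κ _ hκ
    obtain ⟨a, ha⟩ := Function.ne_iff.1 hκ
    rw [max_eq_left, mul_zero]
    have := Finset.single_le_sum (f := fun a => -(if κ a = cubeCell m q x a then (0 : ℝ) else -1))
      (fun b _ => by split_ifs <;> norm_num) (Finset.mem_univ a)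
    simp only [if_neg ha, Finset.sum_neg_distrib] at this
    linarith
  · simp

/-! ### Lower bound for the covering number. -/

theorem exists_map_eq_cons {A : Type} {n : ℕ} (hn : 0 < n) (c : A) (s : Sym A (n - 1)) :
    ∃ K : Fin n → A, K ⟨0, hn⟩ = c ∧
      Multiset.map K Finset.univ.val = c ::ₘ (s : Multiset A) := by
  obtain ⟨n, rfl⟩ : ∃ k, n = k + 1 := ⟨n - 1, by omega⟩
  obtain ⟨s, hs⟩ := s
  induction s using Quotient.inductionOn with
  | h l =>
    have hl : (c :: l).length = n + 1 := by
      have : l.length = n := hs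
      simp [this]
    refine ⟨fun i => (c :: l).get (i.cast hl.symm), rfl, ?_⟩
    have h : List.ofFn (fun i : Fin (n + 1) => (c :: l).get (i.cast hl.symm)) = c :: l :=
      (List.ofFn_congr hl _).symm.trans (List.ofFn_get _)
    rw [Fin.univ_def]
    change ((List.map _ (List.finRange (n + 1)) : List A) : Multiset A) =
      ((c :: l : List A) : Multiset A)
    rw [← List.ofFn_eq_map, h]

/-- The points of the cube with coordinates in `{0, 1 / m, …, 1}`. -/
noncomputable def latticePoint {d m : ℕ} (a : Fin d → Fin (m + 1)) : Cube d := fun i =>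
  ⟨(a i : ℕ) / m, by positivity,
    div_le_one_of_le₀ (by exact_mod_cast Nat.lt_succ_iff.1 (a i).2) (Nat.cast_nonneg m)⟩

theorem eq_of_dist_latticePoint_lt {d m : ℕ} (hm : 0 < m) {a b : Fin d → Fin (m + 1)}
    (h : dist (latticePoint a) (latticePoint b) < 1 / m) : a = b := by
  funext i
  have hi := (dist_le_pi_dist (latticePoint a) (latticePoint b) i).trans_lt h
  have hm' : (0 : ℝ) < m := by exact_mod_cast hm
  rw [Subtype.dist_eq, Real.dist_eq] at hi
  change |((a i : ℕ) : ℝ) / m - ((b i : ℕ) : ℝ) / m| < 1 / m at hi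
  rw [← sub_div, abs_div, abs_of_pos hm', div_lt_div_iff_of_pos_right hm'] at hi
  have : |((a i : ℕ) : ℤ) - ((b i : ℕ) : ℤ)| < 1 := by exact_mod_cast hi
  rw [Int.abs_lt_one_iff] at this
  exact Fin.ext (by omega)

/-- Compactness gives a finite cover, so the infimum is attained and is not the default value `0` of
`sInf ∅`. -/
theorem coveringNumberMod_mem {E : Type} [PseudoMetricSpace E] [CompactSpace E] {n : ℕ}
    (G : Subgroup (Equiv.Perm (Fin n))) {r : ℝ} (hr : 0 < r) :
    ∃ t : Finset (Fin n → E), t.card = coveringNumberMod E G r ∧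
      ∀ X : Fin n → E, ∃ c ∈ t, ∃ σ ∈ G, X ∘ σ ∈ Metric.ball c r := by
  refine Nat.sInf_mem (s := {k | ∃ t : Finset (Fin n → E), t.card = k ∧
    ∀ X : Fin n → E, ∃ c ∈ t, ∃ σ ∈ G, X ∘ σ ∈ Metric.ball c r}) ?_
  obtain ⟨t, -, ht, hcov⟩ := (isCompact_univ (X := Fin n → E)).finite_cover_balls hr
  refine ⟨_, ht.toFinset, rfl, fun X => ?_⟩
  obtain ⟨c, hc, hX⟩ := Set.mem_iUnion₂.1 (hcov (Set.mem_univ X))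
  exact ⟨c, ht.mem_toFinset.2 hc, 1, G.one_mem, hX⟩

/-- A packing argument: realize each pair of a first point and a multiset of `n-1` others by lattice
points. If two such tuples, permuted with index `0` fixed, share an open ball of radius `r`, they
agree up to distance below `2r ≤ 1/m`, hence exactly, and so do their pairs. -/
theorem mul_multichoose_le_coveringNumberMod (d : ℕ) {n m : ℕ} (hn : 0 < n) (hm : 0 < m) {r : ℝ}
    (hr : 0 < r) (hrm : 2 * r ≤ 1 / m) :
    (m + 1) ^ d * ((m + 1) ^ d).multichoose (n - 1) ≤ coveringNumberMod (Cube d)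
      (MulAction.stabilizer (Equiv.Perm (Fin n)) (⟨0, hn⟩ : Fin n)) r := by
  classical
  obtain ⟨t, ht, hcov⟩ := coveringNumberMod_mem (E := Cube d)
    (MulAction.stabilizer (Equiv.Perm (Fin n)) (⟨0, hn⟩ : Fin n)) hr
  rw [← ht]
  choose K hK0 hK using fun p : (Fin d → Fin (m + 1)) × Sym (Fin d → Fin (m + 1)) (n - 1) =>
    exists_map_eq_cons hn p.1 p.2
  choose c hc σ hσ hball using fun p => hcov fun j => latticePoint (K p j)
  have hinj : Function.Injective fun p => (⟨c p, hc p⟩ : t) := by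
    intro p p' hpp
    have hcc : c p = c p' := congrArg Subtype.val hpp
    have hKK : K p ∘ σ p = K p' ∘ σ p' := by
      funext j
      refine eq_of_dist_latticePoint_lt hm ?_
      have h1 := (dist_le_pi_dist _ _ j).trans_lt (Metric.mem_ball.1 (hball p))
      have h2 := (dist_le_pi_dist _ _ j).trans_lt (Metric.mem_ball.1 (hball p'))
      rw [hcc] at h1
      calc _ ≤ _ := dist_triangle_right _ _ (c p' j)
        _ < r + r := add_lt_add h1 h2
        _ ≤ 1 / m := by linarith
    have hfix : ∀ p, σ p ⟨0, hn⟩ = ⟨0, hn⟩ := fun p => MulAction.mem_stabilizer_iff.1 (hσ p)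
    have h0 : p.1 = p'.1 := by
      have := congrFun hKK ⟨0, hn⟩
      simpa [hfix, hK0] using this
    have hmap : ∀ p, Multiset.map (K p ∘ σ p) Finset.univ.val = p.1 ::ₘ (p.2 : Multiset _) := by
      intro p
      rw [← hK p, ← Multiset.map_map]
      congr 1
      exact congrArg Finset.val (Finset.map_univ_equiv (σ p))
    have h1 := hmap p
    rw [hKK, hmap p', h0] at h1
    exact Prod.ext h0 (Subtype.ext ((Multiset.cons_inj_right _).1 h1.symm))
  have := Fintype.card_le_of_injective _ hinj
  rw [Fintype.card_prod, Sym.card_sym_eq_multichoose] at this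
  simpa using this

/-! ### Configurations of cells up to permutation. -/

/-- The number of indices `j ≠ i` with `K j = c`. -/
def cellCount {n M : ℕ} (K : Fin n → Fin M) (i : Fin n) (c : ℕ) : ℕ :=
  ((Finset.univ.erase i).filter fun j => (K j : ℕ) = c).card

/-- The index of a configuration of `n` cells with a distinguished token `i`, up to permutations. -/
def cellIndex {n M : ℕ} (K : Fin n → Fin M) (i : Fin n) : ℕ :=
  K i * M.multichoose (n - 1) + compositionRank M (cellCount K i)

section CellIndex

variable {n M : ℕ}

theorem sum_cellCount_mul (K : Fin n → Fin M) (i : Fin n) (g : ℕ → ℕ) :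
    ∑ c ∈ Finset.range M, cellCount K i c * g c = ∑ j ∈ Finset.univ.erase i, g (K j) := by
  rw [← Finset.sum_fiberwise_of_maps_to (t := Finset.range M) (g := fun j => (K j : ℕ))
    fun j _ => Finset.mem_range.2 (K j).2]
  refine Finset.sum_congr rfl fun c _ => ?_
  rw [Finset.sum_congr rfl fun j hj => by rw [(Finset.mem_filter.1 hj).2], Finset.sum_const,
    smul_eq_mul, cellCount]

theorem sum_cellCount (K : Fin n → Fin M) (i : Fin n) :
    ∑ c ∈ Finset.range M, cellCount K i c = n - 1 := by
  simpa using sum_cellCount_mul K i fun _ => 1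

theorem cellIndex_lt (K : Fin n → Fin M) (i : Fin n) :
    cellIndex K i < M * M.multichoose (n - 1) := by
  have h1 := compositionRank_lt M (cellCount K i)
  rw [sum_cellCount] at h1
  have h2 := Nat.mul_le_mul_right (M.multichoose (n - 1)) (Nat.succ_le_of_lt (K i).2)
  rw [Nat.succ_mul] at h2
  rw [cellIndex]
  omega

/-- Quotient and remainder by `M.multichoose (n-1)` recover the distinguished cell and the rank,
hence all counts. So the maps `j ↦ (K j, j = i)` and `j ↦ (K' j, j = i')` have fibres of equal size,
and matching the fibres gives `τ`. -/
theorem exists_perm_of_cellIndex_eq {K K' : Fin n → Fin M} {i i' : Fin n}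
    (h : cellIndex K i = cellIndex K' i') :
    ∃ τ : Equiv.Perm (Fin n), K' ∘ τ = K ∧ τ i = i' := by
  have h1 := compositionRank_lt M (cellCount K i)
  have h2 := compositionRank_lt M (cellCount K' i')
  rw [sum_cellCount] at h1 h2
  have hdiv : (K i : ℕ) = K' i' := by
    have := congrArg (· / M.multichoose (n - 1)) h
    simpa only [cellIndex, Nat.mul_comm _ (M.multichoose (n - 1)),
      Nat.mul_add_div (Nat.zero_lt_of_lt h1), Nat.div_eq_of_lt h1, Nat.div_eq_of_lt h2,
      Nat.add_zero] using this
  have hrank : compositionRank M (cellCount K i) = compositionRank M (cellCount K' i') := by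
    rw [cellIndex, cellIndex, hdiv] at h
    omega
  have hcount := compositionRank_inj
    ((sum_cellCount K i).trans (sum_cellCount K' i').symm) hrank
  let κ : Fin n → Fin M × Prop := fun j => (K j, j = i)
  let κ' : Fin n → Fin M × Prop := fun j => (K' j, j = i')
  have hfib : ∀ p, Nonempty ({j // κ j = p} ≃ {j // κ' j = p}) := by
    classical
    rintro ⟨c, P⟩
    refine Fintype.card_eq.1 ?_
    rw [Fintype.card_subtype, Fintype.card_subtype]
    by_cases hP : P
    · have aux : ∀ (K : Fin n → Fin M) (i : Fin n),
          (Finset.univ.filter fun j => ((K j, j = i) : Fin M × Prop) = (c, P)) =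
            if K i = c then {i} else ∅ := by
        intro K i
        ext j
        simp only [Finset.mem_filter, Finset.mem_univ, true_and, Prod.mk.injEq, hP, eq_iff_iff,
          iff_true]
        split_ifs with hc
        · simp only [Finset.mem_singleton]
          exact ⟨fun h => h.2, fun h => ⟨h ▸ hc, h⟩⟩
        · simp only [Finset.notMem_empty, iff_false]
          rintro ⟨h, rfl⟩
          exact hc h
      rw [aux, aux, Fin.ext hdiv]
      split_ifs <;> simp
    · have aux : ∀ (K : Fin n → Fin M) (i : Fin n),
          (Finset.univ.filter fun j => ((K j, j = i) : Fin M × Prop) = (c, P)).card =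
            cellCount K i c := by
        intro K i
        rw [cellCount]
        congr 1
        ext j
        simp [hP, Fin.ext_iff, and_comm]
      rw [aux, aux, hcount c c.2]
  have hτ := Equiv.ofFiberEquiv_map (f := κ) (g := κ') fun p => (hfib p).some
  refine ⟨_, funext fun j => congrArg Prod.fst (hτ j), ?_⟩
  exact (congrArg Prod.snd (hτ i)).mpr rfl

end CellIndex

/-! ### The two Transformer blocks. -/

section Blocks

variable {d n N : ℕ}

/-- The affine layer `y ↦ (0, 0, y, -y)`. -/
def duplicateMatrix (d N : ℕ) : Matrix (TokenIdx d N) (Fin N) ℝ :=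
  Matrix.of (Sum.elim 0 (Sum.elim 0 (Sum.elim (fun p q => if p = q then 1 else 0)
    fun p q => if p = q then -1 else 0)))

/-- The value matrix that puts `n` times the third part of a token into the fourth part. -/
def sumMatrix (d N n : ℕ) : Matrix (TokenIdx d N) (TokenIdx d N) ℝ :=
  Matrix.of (Sum.elim 0 (Sum.elim 0 (Sum.elim
    (fun p => Sum.elim 0 (Sum.elim 0 (Sum.elim 0 fun q => if p = q then (n : ℝ) else 0))) 0)))

/-- The attention head with uniform weights and value matrix `sumMatrix`. -/
def sumHead (d N n : ℕ) : AttentionHead (TokenIdx d N) := ⟨0, 0, sumMatrix d N n⟩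

theorem sumHead_weights (X : Matrix (Fin n) (TokenIdx d N) ℝ) (i j : Fin n) :
    (sumHead d N n).weights X i j = 1 / n := by
  simp [sumHead, AttentionHead.weights, rowSoftmax]

/-- The first block: attention without effect, and `Φ` followed by `duplicateMatrix`. -/
def encoderBlock {ws : List ℕ} {Φ : (Fin d → ℝ) → Fin N → ℝ} (hΦ : IsReLUNet ws Φ) :
    TransformerBlock (TokenIdx d N) where
  att := ⟨1, fun _ => ⟨0, 0, 0⟩, 0⟩
  FC z := duplicateMatrix d N *ᵥ Φ (pointPart z) + 0
  isReLUNet_FC := ⟨ws, by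
    have h1 : IsReLUNet [] fun y => duplicateMatrix d N *ᵥ y + 0 := ⟨_, _, fun _ => rfl⟩
    have h2 := hΦ.comp_affine (A := fun z : TokenIdx d N → ℝ => pointPart z) fun a => .coord _
    simpa only [List.append_nil] using h1.comp h2⟩

/-- The second block: the head `sumHead`, and `ρ` written to the first coordinate. -/
def decoderBlock (n : ℕ) {ws : List ℕ} {ρ : (Fin N ⊕ Fin N → ℝ) → Fin 1 → ℝ}
    (hρ : IsReLUNet ws ρ) : TransformerBlock (TokenIdx d N) where
  att := ⟨1, fun _ => sumHead d N n, Matrix.of fun p => (1 : Matrix _ _ ℝ) p.2⟩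
  FC z := ρ (lastPart z) 0 • (Sum.elim 1 0 : TokenIdx d N → ℝ) + 0
  isReLUNet_FC := ⟨ws, by
    have h1 : IsReLUNet [] fun (y : Fin 1 → ℝ) => y 0 • (Sum.elim 1 0 : TokenIdx d N → ℝ) + 0 := by
      refine isReLUNet_nil_iff.2 fun b => ?_
      have := (IsAffineForm.coord (0 : Fin 1)).const_mul ((Sum.elim 1 0 : TokenIdx d N → ℝ) b)
      simpa [mul_comm] using this
    have h2 := hρ.comp_affine (A := fun z : TokenIdx d N → ℝ => lastPart z) fun a => .coord _
    simpa only [List.append_nil] using h1.comp h2⟩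

theorem encoderBlock_apply {ws : List ℕ} {Φ : (Fin d → ℝ) → Fin N → ℝ} (hΦ : IsReLUNet ws Φ)
    (X : Fin n → Cube d) (i : Fin n) :
    (encoderBlock hΦ).apply (padTokens N X) i = Sum.elim (fun _ => 0) (Sum.elim (point (X i))
      (Sum.elim (Φ (point (X i))) (-Φ (point (X i))))) := by
  have hmid : (encoderBlock hΦ).mid (padTokens N X) = padTokens N X := by
    have h0 : (encoderBlock hΦ).att.apply (padTokens N X) = 0 := Matrix.mul_zero _
    rw [TransformerBlock.mid, h0, add_zero]
  have hrow : (encoderBlock hΦ).apply (padTokens N X) i =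
      padTokens N X i + (duplicateMatrix d N *ᵥ Φ (point (X i)) + 0) := by
    rw [TransformerBlock.apply, hmid]
    rfl
  rw [hrow]
  funext k
  rcases k with k | k | k | k
  · simp [duplicateMatrix, padTokens, Matrix.mulVec, dotProduct]
  · simp [duplicateMatrix, padTokens, Matrix.mulVec, dotProduct]
  · simp [duplicateMatrix, padTokens, Matrix.mulVec, dotProduct]
  · simp [duplicateMatrix, padTokens, Matrix.mulVec, dotProduct]

/-- The factor `n` in the value matrix cancels the uniform weight `1/n`. After the first block the
fourth part holds `-Φ(xᵢ)`, so the residual connection removes the `i`-th term of the sum. -/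
theorem decoderBlock_mid {ws : List ℕ} {ρ : (Fin N ⊕ Fin N → ℝ) → Fin 1 → ℝ} (hn : 0 < n)
    (hρ : IsReLUNet ws ρ) (X : Matrix (Fin n) (TokenIdx d N) ℝ) (i : Fin n) :
    lastPart ((decoderBlock n hρ).mid X i) = Sum.elim (fun p => X i (Sum.inr (Sum.inr (Sum.inl p))))
      (fun p => X i (Sum.inr (Sum.inr (Sum.inr p))) +
        ∑ j, X j (Sum.inr (Sum.inr (Sum.inl p)))) := by
  have hn' : (n : ℝ) ≠ 0 := by exact_mod_cast hn.ne'
  have hatt : ∀ k, (decoderBlock n hρ).att.apply X i k = ∑ j, 1 / (n : ℝ) *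
      ∑ l, X j l * sumMatrix d N n l k := by
    intro k
    have h1 : (decoderBlock n hρ).att.apply X i k =
        (sumHead d N n).apply X i k := by
      change ∑ p : Fin 1 × TokenIdx d N, (sumHead d N n).apply X i p.2 *
        (1 : Matrix _ _ ℝ) p.2 k = _
      rw [Fintype.sum_prod_type]
      simp [Matrix.one_apply]
    rw [h1, AttentionHead.apply, Matrix.mul_apply]
    refine Finset.sum_congr rfl fun j _ => ?_
    rw [sumHead_weights, Matrix.mul_apply]
    rfl
  funext k
  rcases k with k | k
  · change X i _ + (decoderBlock n hρ).att.apply X i _ = _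
    rw [hatt]
    simp [sumMatrix, Fintype.sum_sum_type]
  · change X i _ + (decoderBlock n hρ).att.apply X i _ = _
    rw [hatt]
    simp [sumMatrix, Fintype.sum_sum_type, mul_comm, hn']

/-- The two-block Transformer that evaluates `ρ` at `(Φ(xᵢ), ∑_{j ≠ i} Φ(xⱼ))`. -/
theorem exists_blocks (hn : 0 < n) {ws ws' : List ℕ} {Φ : (Fin d → ℝ) → Fin N → ℝ}
    {ρ : (Fin N ⊕ Fin N → ℝ) → Fin 1 → ℝ} (hΦ : IsReLUNet ws Φ) (hρ : IsReLUNet ws' ρ) :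
    ∃ B₁ B₂ : TransformerBlock (TokenIdx d N),
      (∃ (A : Matrix (TokenIdx d N) (Fin N) ℝ) (b : TokenIdx d N → ℝ),
        ∀ z, B₁.FC z = A *ᵥ Φ (pointPart z) + b) ∧
      (∃ u v : TokenIdx d N → ℝ, ∀ z, B₂.FC z = ρ (lastPart z) 0 • u + v) ∧
      B₂.att.numHeads = 1 ∧
      (∀ (X : Fin n → Cube d) (h : Fin B₂.att.numHeads) (i j : Fin n),
        (B₂.att.heads h).weights (B₁.apply (padTokens N X)) i j = 1 / n) ∧
      (∀ (X : Fin n → Cube d) (i : Fin n),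
        lastPart (B₂.mid (B₁.apply (padTokens N X)) i) =
          Sum.elim (Φ (point (X i))) (∑ j ∈ Finset.univ.erase i, Φ (point (X j)))) ∧
      ∀ (X : Fin n → Cube d) (i : Fin n),
        transformer [B₁, B₂] (padTokens N X) i (Sum.inl ()) =
          ρ (Sum.elim (Φ (point (X i))) (∑ j ∈ Finset.univ.erase i, Φ (point (X j)))) 0 := by
  have hmid : ∀ (X : Fin n → Cube d) (i : Fin n),
      lastPart ((decoderBlock n hρ).mid ((encoderBlock hΦ).apply (padTokens N X)) i) =
        Sum.elim (Φ (point (X i))) (∑ j ∈ Finset.univ.erase i, Φ (point (X j))) := by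
    intro X i
    rw [decoderBlock_mid hn]
    simp only [encoderBlock_apply]
    funext k
    rcases k with k | k
    · rfl
    · have := Finset.add_sum_erase Finset.univ (fun j => Φ (point (X j)) k) (Finset.mem_univ i)
      simp only [Sum.elim_inr, Sum.elim_inl, Pi.neg_apply, Finset.sum_apply]
      linarith
  refine ⟨encoderBlock hΦ, decoderBlock n hρ, ⟨_, _, fun _ => rfl⟩, ⟨_, _, fun _ => rfl⟩, rfl,
    fun X => fun _ => sumHead_weights _, hmid, fun X i => ?_⟩
  change (encoderBlock hΦ).apply (padTokens N X) i (Sum.inl ()) +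
    (ρ (lastPart ((decoderBlock n hρ).mid ((encoderBlock hΦ).apply (padTokens N X)) i)) 0 •
      (Sum.elim 1 0 : TokenIdx d N → ℝ) + 0) (Sum.inl ()) = _
  rw [hmid, encoderBlock_apply]
  simp

end Blocks

/-! ### Modulus of continuity and quantization. -/

section Modulus

variable {d n m : ℕ}

theorem abs_sub_le_modulus {f : (Fin n → Cube d) → Fin n → ℝ} {ε : ℝ}
    (hω : modulusOfContinuity f ε ≠ ⊤) {X Y : Fin n → Cube d} (h : dist X Y ≤ ε) (i : Fin n) :
    |f X i - f Y i| ≤ (modulusOfContinuity f ε).toReal := by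
  have h1 : edist (f X) (f Y) ≤ modulusOfContinuity f ε :=
    le_iSup_of_le X (le_iSup_of_le Y (le_iSup_of_le h le_rfl))
  have h2 := ENNReal.toReal_mono hω h1
  rw [edist_dist, ENNReal.toReal_ofReal dist_nonneg] at h2
  exact (dist_le_pi_dist (f X) (f Y) i).trans h2

/-- The point `t • x` of the cube. -/
def scalePoint (t : Set.Icc (0 : ℝ) 1) (x : Cube d) : Cube d := fun a =>
  ⟨t * x a, mul_nonneg t.2.1 (x a).2.1, mul_le_one₀ t.2.2 (x a).2.1 (x a).2.2⟩

/-- The segment from `0` to `X` is walked in `2m` steps of length at most `1/(2m)`, each costing one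
modulus. -/
theorem abs_sub_le_mul_modulus (hm : 0 < m) {f : (Fin n → Cube d) → Fin n → ℝ}
    (hω : modulusOfContinuity f (1 / (2 * m)) ≠ ⊤) (X : Fin n → Cube d) (i : Fin n) :
    |f X i - f (fun _ _ => 0) i| ≤ 2 * m * (modulusOfContinuity f (1 / (2 * m))).toReal := by
  have hm' : (0 : ℝ) < m := by exact_mod_cast hm
  let t : ℕ → Set.Icc (0 : ℝ) 1 := fun k => Set.projIcc 0 1 zero_le_one (k / (2 * m))
  have ht : ∀ k, dist (t (k + 1)) (t k) ≤ 1 / (2 * m) := by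
    intro k
    refine (Set.abs_projIcc_sub_projIcc zero_le_one).trans (le_of_eq ?_)
    rw [← sub_div, Nat.cast_succ, add_sub_cancel_left, abs_of_pos (by positivity)]
  have key : ∀ k : ℕ, |f (fun j => scalePoint (t k) (X j)) i - f (fun _ _ => 0) i| ≤
      k * (modulusOfContinuity f (1 / (2 * m))).toReal := by
    intro k
    induction k with
    | zero =>
      have h0 : (fun j => scalePoint (t 0) (X j)) = fun _ _ => 0 := by
        funext j a
        ext
        simp [t, scalePoint, Set.projIcc]
      rw [h0]
      simp
    | succ k ih =>
      have hstep := abs_sub_le_modulus hω (X := fun j => scalePoint (t (k + 1)) (X j))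
        (Y := fun j => scalePoint (t k) (X j)) (by
          refine (dist_pi_le_iff (by positivity)).2 fun j => (dist_pi_le_iff (by positivity)).2
            fun a => le_trans ?_ (ht k)
          rw [Subtype.dist_eq, Subtype.dist_eq, Real.dist_eq, Real.dist_eq]
          change |(t (k + 1) : ℝ) * X j a - t k * X j a| ≤ _
          rw [← sub_mul, abs_mul, abs_of_nonneg (X j a).2.1]
          exact mul_le_of_le_one_right (abs_nonneg _) (X j a).2.2) i
      refine (abs_sub_le _ _ _).trans ((add_le_add hstep ih).trans (le_of_eq ?_))
      push_cast
      ring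
  have h1 : (fun j => scalePoint (t (2 * m)) (X j)) = X := by
    have : t (2 * m) = 1 := by
      ext
      simp [t, Set.projIcc, hm.ne']
    funext j a
    ext
    simp [this, scalePoint]
  have := key (2 * m)
  rw [h1] at this
  exact_mod_cast this

/-- Quantization of the values of an equivariant function with `8 m + 1` labels. -/
theorem exists_quantization (hn : 0 < n) (hm : 0 < m) {f : (Fin n → Cube d) → Fin n → ℝ}
    (hf : ∀ (σ : Equiv.Perm (Fin n)) (X : Fin n → Cube d), f (X ∘ σ) = f X ∘ σ) :
    ∃ (base : ℝ) (lab : ℝ → ℕ), (∀ g, lab g ≤ 8 * m) ∧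
      (modulusOfContinuity f (1 / (2 * m)) ≠ ⊤ → ∀ X i,
        base + (modulusOfContinuity f (1 / (2 * m))).toReal / 2 * lab (f X i) ≤ f X i ∧
        f X i ≤ base + (modulusOfContinuity f (1 / (2 * m))).toReal / 2 * (lab (f X i) + 1)) := by
  set w := (modulusOfContinuity f (1 / (2 * m))).toReal with hw
  have hw0 : 0 ≤ w := ENNReal.toReal_nonneg
  have hm' : (0 : ℝ) < m := by exact_mod_cast hm
  let f₀ := f (fun _ _ => 0) ⟨0, hn⟩
  -- The values fill an interval of length `4mw`, that is `8m` steps of `w/2`. The minimum keeps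
  -- labels bounded for every real argument, also when the modulus is infinite.
  refine ⟨f₀ - 2 * m * w, fun g => min (8 * m) ⌊(g - (f₀ - 2 * m * w)) / (w / 2)⌋₊,
    fun g => min_le_left _ _, fun hω X i => ?_⟩
  -- The constant tuple is fixed by every swap, so equivariance makes all coordinates of its image
  -- equal.
  have h0 : f (fun _ _ => 0) i = f₀ := by
    have := congrFun (hf (Equiv.swap ⟨0, hn⟩ i) fun _ _ => 0) ⟨0, hn⟩
    simpa [Function.comp_def, f₀] using this.symm
  have hrange := abs_sub_le_mul_modulus hm hω X i
  rw [h0, ← hw, abs_le] at hrange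
  have hy : 0 ≤ f X i - (f₀ - 2 * m * w) := by linarith
  rcases hw0.eq_or_lt with hw1 | hw1
  · rw [← hw1] at hrange ⊢
    simp only [mul_zero, neg_zero] at hrange
    simp only [mul_zero, zero_div, zero_mul, sub_zero, add_zero]
    constructor <;> linarith
  have hle : ⌊(f X i - (f₀ - 2 * m * w)) / (w / 2)⌋₊ ≤ 8 * m := by
    refine Nat.floor_le_of_le ?_
    rw [div_le_iff₀ (by positivity)]
    push_cast
    linarith
  beta_reduce
  rw [min_eq_right hle]
  have h1 := Nat.floor_le (div_nonneg hy (by positivity : (0 : ℝ) ≤ w / 2))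
  have h2 := (Nat.lt_floor_add_one ((f X i - (f₀ - 2 * m * w)) / (w / 2))).le
  rw [le_div_iff₀ (by positivity)] at h1
  rw [div_le_iff₀ (by positivity)] at h2
  constructor <;> linarith

end Modulus

/-! ### The decoder, its depth, and the labels. -/

/-- The decoder: it finds the label of the configuration of cells in each channel, and takes an
approximate median of the labels. -/
theorem exists_decoder {n N M T b C h : ℕ} (hn : 0 < n) (hN : N = 2 * h + 1) (hM : 0 < M)
    (hT : 0 < T) (hb : 0 < b) (hC : 9 ≤ C) (v : Fin N → ℕ → ℕ)
    (hv : ∀ q x, v q x < 2 ^ T) (base δ : ℝ) :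
    ∃ ρ : (Fin N ⊕ Fin N → ℝ) → Fin 1 → ℝ,
      IsReLUNet (List.replicate (C * M) (C * (n + 1) * N) ++
        List.replicate (M * M.multichoose (n - 1) / b + b * T * 2 + T * 2) (12 * N)) ρ ∧
      ∀ (K : Fin N → Fin n → Fin M) (i : Fin n) (y : Fin N ⊕ Fin N → ℝ) (G : Finset (Fin N))
        (lo hi : ℕ), h < G.card →
        (∀ q ∈ G, y (Sum.inl q) = (n + 1) ^ (K q i : ℕ) ∧
          y (Sum.inr q) = ∑ j ∈ Finset.univ.erase i, ((n : ℝ) + 1) ^ (K q j : ℕ)) →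
        (∀ q ∈ G, lo ≤ v q (cellIndex (K q) i) ∧ v q (cellIndex (K q) i) ≤ hi) →
        ∃ a : ℝ, (lo : ℝ) - 1 < a ∧ a < hi + 1 ∧ ρ y 0 = base + δ * a := by
  set P := M * M.multichoose (n - 1) with hP
  choose F hF hFv using fun q => exists_memorization P T b hT hb (v q) fun x _ => hv q x
  obtain ⟨V, hV, hVspec⟩ := exists_vote (ι := Fin N) h T (12 * N) (by simpa using hN)
    (by rw [Fintype.card_fin]; omega)
  have hdec : IsReLUNet (List.replicate (C * M) (C * (n + 1)))
      (runDown (fun k x => rankStep n k (digitStep n (M.multichoose (n - 1)) k x)) M) := by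
    refine (isReLUNet_decode ?_ M).replicate_mono (by omega) ?_
    · nlinarith
    · rw [Nat.mul_comm]
      exact Nat.mul_le_mul_right M (by omega)
  have hpar := IsReLUNet.parallel fun _ : Fin N => hdec
  have hmem := IsReLUNet.parallel hF
  rw [List.map_replicate, Fintype.card_fin] at hpar hmem
  have hpar' := hpar.comp_affine (A := fun (y : Fin N ⊕ Fin N → ℝ) (p : Fin N × Fin 4) =>
    (![y (Sum.inr p.1), (n - 1 : ℕ), y (Sum.inl p.1), 0] : Fin 4 → ℝ) p.2) fun p => by
      obtain ⟨q, s⟩ := p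
      fin_cases s
      · exact .coord _
      · exact .const _
      · exact .coord _
      · exact .const _
  have hmem' := hmem.comp_affine (A := fun (y : Fin N × Fin 4 → ℝ) (p : Fin N × Fin 1) =>
    y (p.1, 3)) fun p => .coord _
  have hV' := hV.comp_affine (A := fun (y : Fin N × Fin 1 → ℝ) (q : Fin N) => y (q, 0))
    fun q => .coord _
  have hout : IsReLUNet [] fun (y : Fin 1 → ℝ) (_ : Fin 1) => base + δ * y 0 :=
    isReLUNet_nil_iff.2 fun _ => (IsAffineForm.const base).add ((IsAffineForm.coord _).const_mul δ)
  have hnet := (hout.comp (hV'.comp hmem')).comp hpar'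
  rw [List.append_nil, Nat.mul_comm N 12, Nat.mul_comm N (C * (n + 1)),
    ← List.replicate_add] at hnet
  refine ⟨_, hnet, fun K i y G lo hi hG hy hlab => ?_⟩
  obtain ⟨q₀, hq₀⟩ : G.Nonempty := Finset.card_pos.1 (by omega)
  have key := hVspec G (fun q => F q (fun _ => runDown
    (fun k x => rankStep n k (digitStep n (M.multichoose (n - 1)) k x)) M
    ![y (Sum.inr q), (n - 1 : ℕ), y (Sum.inl q), 0] 3) 0) (fun q => v q (cellIndex (K q) i)) lo hi
    hG (fun q hq => ⟨?_, hlab q hq⟩) ((hlab q₀ hq₀).1.trans_lt (hv _ _))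
  · exact ⟨_, key.1, key.2, rfl⟩
  · have hsum := sum_cellCount (K q) i
    have hstate : (![y (Sum.inr q), (n - 1 : ℕ), y (Sum.inl q), 0] : Fin 4 → ℝ) =
        decodeState n M (cellCount (K q) i) (K q i) 0 := by
      rw [decodeState, sum_cellCount_mul, hsum, if_pos (K q i).2, (hy q hq).1, (hy q hq).2]
      push_cast
      rfl
    rw [hstate, decode_spec hn (by omega), if_pos (K q i).2, Nat.zero_add]
    exact hFv q _ (cellIndex_lt (K q) i)

theorem size_le_mul_log {m : ℕ} (hm : 0 < m) :
    (Nat.size (8 * m) : ℝ) ≤ 6 * Real.log (2 * m + 1) := by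
  have hm' : (1 : ℝ) ≤ m := by exact_mod_cast hm
  obtain ⟨t, ht⟩ : ∃ t, Nat.size (8 * m) = t + 1 :=
    ⟨_, (Nat.succ_pred_eq_of_pos (Nat.size_pos.2 (by omega))).symm⟩
  have h1 : 2 ^ t ≤ 8 * m := Nat.lt_size.1 (by omega)
  have h2 : (2 : ℝ) ^ (t + 1) ≤ (2 * m + 1) ^ 4 := by
    have h1' : (2 : ℝ) ^ t ≤ 8 * m := by exact_mod_cast h1
    have h3 : (9 : ℝ) ≤ (2 * m + 1) ^ 2 := by nlinarith
    have h4 : 4 * (m : ℝ) ≤ (2 * m + 1) ^ 2 := by nlinarith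
    calc (2 : ℝ) ^ (t + 1) = 2 ^ t * 2 := pow_succ _ _
      _ ≤ (2 * m + 1) ^ 2 * (2 * m + 1) ^ 2 := by nlinarith
      _ = _ := by ring
  have h3 := Real.log_le_log (by positivity) h2
  rw [Real.log_pow, Real.log_pow] at h3
  push_cast at h3
  have h4 := Real.log_two_gt_d9
  rw [ht]
  push_cast
  nlinarith

/-- The length of the blocks can be chosen such that the depth is of the order of the square root
of the total number of bits of the labels. -/
theorem exists_block_length {n m P R : ℕ} (hn : 0 < n) (hm : 0 < m) (hP : m + 1 ≤ P)
    (hPR : P ≤ R) : ∃ b, 0 < b ∧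
      ((P / b + b * Nat.size (8 * m) * 2 + Nat.size (8 * m) * 2 : ℕ) : ℝ) ≤
        33 * √(R * Real.log (n * (2 * m + 1) * R)) := by
  have hTlog := size_le_mul_log hm
  have hT : 0 < Nat.size (8 * m) := Nat.size_pos.2 (by omega)
  have hT4 : Nat.size (8 * m) ≤ 4 * P := by
    have : Nat.size (8 * m) ≤ m + 3 := Nat.size_le.2 (by
      have := Nat.lt_two_pow_self (n := m)
      rw [pow_add]
      omega)
    omega
  set T := Nat.size (8 * m)
  have hT' : (0 : ℝ) < T := by exact_mod_cast hT
  have hP' : (0 : ℝ) < P := by exact_mod_cast (by omega : 0 < P)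
  have hT4' : (T : ℝ) ≤ 4 * P := by exact_mod_cast hT4
  set s := √((P : ℝ) * T) with hs
  have hs0 : 0 < s := Real.sqrt_pos.2 (by positivity)
  have hss : s * s = P * T := Real.mul_self_sqrt (by positivity)
  have hTs : (T : ℝ) ≤ 2 * s := by nlinarith
  have hsR : s ≤ 3 * √(R * Real.log (n * (2 * m + 1) * R)) := by
    have hR : (P : ℝ) ≤ R := by exact_mod_cast hPR
    have hR1 : (1 : ℝ) ≤ R := by exact_mod_cast (by omega : 1 ≤ R)
    have hn1 : (1 : ℝ) ≤ n := by exact_mod_cast hn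
    have hm1 : (0 : ℝ) < 2 * m + 1 := by positivity
    have hlog : Real.log (2 * m + 1) ≤ Real.log (n * (2 * m + 1) * R) := by
      refine Real.log_le_log hm1 ?_
      calc (2 * m + 1 : ℝ) = 1 * (2 * m + 1) * 1 := by ring
        _ ≤ n * (2 * m + 1) * R := by gcongr
    have h3 : (3 : ℝ) = √(3 ^ 2) := (Real.sqrt_sq (by norm_num)).symm
    rw [h3, ← Real.sqrt_mul (by norm_num)]
    refine Real.sqrt_le_sqrt ?_
    have hl : (T : ℝ) ≤ 6 * Real.log (n * (2 * m + 1) * R) := by linarith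
    calc (P : ℝ) * T ≤ R * (6 * Real.log (n * (2 * m + 1) * R)) := by gcongr
      _ ≤ _ := by nlinarith
  -- With `s = √(PT)` this balances `P / b ≤ s` against `bT ≤ s + T`. As `T ≤ 2s`, the depth is at
  -- most `3s + 4T ≤ 11s`, and `s` is at most three times the square root in the claim: this gives
  -- `33`.
  refine ⟨⌈s / T⌉₊, Nat.ceil_pos.2 (by positivity), ?_⟩
  have hb1 : s / T ≤ (⌈s / T⌉₊ : ℝ) := Nat.le_ceil _
  have hb2 : (⌈s / T⌉₊ : ℝ) < s / T + 1 := Nat.ceil_lt_add_one (by positivity)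
  have h1 : ((P / ⌈s / T⌉₊ : ℕ) : ℝ) ≤ s := by
    refine Nat.cast_div_le.trans ?_
    rw [div_le_iff₀ (lt_of_lt_of_le (by positivity) hb1)]
    calc (P : ℝ) = s * (s / T) := by field_simp; linarith
      _ ≤ _ := by gcongr
  have h2 : (⌈s / T⌉₊ : ℝ) * T ≤ s + T := by
    calc _ ≤ (s / T + 1) * T := by gcongr
      _ = s + T := by field_simp
  push_cast
  linarith

theorem Nat.multichoose_pos {k : ℕ} (hk : 0 < k) (r : ℕ) : 0 < k.multichoose r := by
  obtain ⟨k, rfl⟩ : ∃ j, k = j + 1 := ⟨k - 1, by omega⟩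
  have := Nat.multichoose_succ_mono k (Nat.zero_le r)
  rw [Nat.multichoose_zero_right] at this
  omega

/-- Labels of the configurations of cells: the label of the value of `f` at the tuple of centres
depends on the index of the configuration only. -/
theorem exists_label {d n M : ℕ} {f : (Fin n → Cube d) → Fin n → ℝ}
    (hf : ∀ (σ : Equiv.Perm (Fin n)) (X : Fin n → Cube d), f (X ∘ σ) = f X ∘ σ)
    (center : Fin M → Cube d) (lab : ℝ → ℕ) {B : ℕ} (hlab : ∀ g, lab g ≤ B) :
    ∃ v : ℕ → ℕ, (∀ p, v p ≤ B) ∧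
      ∀ (K : Fin n → Fin M) (i : Fin n), v (cellIndex K i) = lab (f (center ∘ K) i) := by
  classical
  refine ⟨fun p => if h : ∃ q : (Fin n → Fin M) × Fin n, cellIndex q.1 q.2 = p then
    lab (f (center ∘ h.choose.1) h.choose.2) else 0, fun p => ?_, fun K i => ?_⟩
  · beta_reduce
    split_ifs
    exacts [hlab _, Nat.zero_le _]
  · have h : ∃ q : (Fin n → Fin M) × Fin n, cellIndex q.1 q.2 = cellIndex K i := ⟨(K, i), rfl⟩
    obtain ⟨τ, hτ, hi⟩ := exists_perm_of_cellIndex_eq h.choose_spec.symm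
    beta_reduce
    rw [dif_pos h, ← hi]
    have hfτ := congrFun (hf τ (center ∘ h.choose.1)) i
    rw [Function.comp_assoc, hτ] at hfτ
    exact congrArg lab hfτ.symm

/-! ### Assembly and error bound. -/

theorem mainTheorem10 :
    ∃ C : ℕ, 0 < C ∧
    ∀ (d n m N : ℕ) (_hd : 0 < d) (hn : 0 < n) (_hm : 0 < m) (_hN : N = 2 * d * n + 1)
      (f : (Fin n → Cube d) → Fin n → ℝ)
      (_hf : ∀ (σ : Equiv.Perm (Fin n)) (X : Fin n → Cube d), f (X ∘ σ) = f X ∘ σ),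
    ∃ (L : ℕ) (Φ : (Fin d → ℝ) → Fin N → ℝ) (ρ : (Fin N ⊕ Fin N → ℝ) → Fin 1 → ℝ)
      (B₁ B₂ : TransformerBlock (TokenIdx d N)),
      -- the architecture of `Φ`
      IsReLUNet [2 * d * (2 * d * n + 1) * (m + 1), 2 * d * (2 * d * n + 1) * (m + 1),
        2 * d * (2 * d * n + 1) * (m + 1), (2 * d * n + 1) * (m + 1) ^ d] Φ ∧
      -- the architecture of `ρ`
      IsReLUNet (List.replicate (C * (m + 1) ^ d) (C * (n + 1) * (2 * d * n + 1)) ++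
        List.replicate L (12 * (2 * d * n + 1))) ρ ∧
      (∃ Nr : ℕ,
        Nr = coveringNumberMod (Cube d)
          (MulAction.stabilizer (Equiv.Perm (Fin n)) (⟨0, hn⟩ : Fin n))
          (1 / (2 * (m : ℝ) * (2 * n * d + 1))) ∧
        (L : ℝ) ≤ C * max (Real.sqrt (Nr * Real.log (n * (2 * m + 1) * Nr)))
          (Real.log (2 * n * d + 1) ^ 2)) ∧
      -- the first feed-forward part is `Φ` followed by an affine layer of width `2N+d+1`
      (∃ (A : Matrix (TokenIdx d N) (Fin N) ℝ) (b : TokenIdx d N → ℝ),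
        ∀ z, B₁.FC z = A *ᵥ Φ (pointPart z) + b) ∧
      -- the second one is `ρ` on the last `2N` coordinates, its value put into a token affinely
      (∃ u v : TokenIdx d N → ℝ, ∀ z, B₂.FC z = ρ (lastPart z) 0 • u + v) ∧
      -- the second block has one head; it is uniform and produces the leave-one-out sums
      B₂.att.numHeads = 1 ∧
      (∀ (X : Fin n → Cube d) (h : Fin B₂.att.numHeads) (i j : Fin n),
        (B₂.att.heads h).weights (B₁.apply (padTokens N X)) i j = 1 / n) ∧
      (∀ (X : Fin n → Cube d) (i : Fin n),
        lastPart (B₂.mid (B₁.apply (padTokens N X)) i) =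
          Sum.elim (Φ (point (X i))) (∑ j ∈ Finset.univ.erase i, Φ (point (X j)))) ∧
      -- the output of the two-block network and the error bound
      ∀ (X : Fin n → Cube d) (i : Fin n),
        transformer [B₁, B₂] (padTokens N X) i (Sum.inl ()) =
          ρ (Sum.elim (Φ (point (X i))) (∑ j ∈ Finset.univ.erase i, Φ (point (X j)))) 0 ∧
        ENNReal.ofReal |f X i - transformer [B₁, B₂] (padTokens N X) i (Sum.inl ())| ≤
          2 * modulusOfContinuity f (1 / (2 * m)) := by
  refine ⟨33, by norm_num, fun d n m N hd hn hm hN f hf => ?_⟩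
  have hm' : (0 : ℝ) < m := by exact_mod_cast hm
  have hM : 0 < (m + 1) ^ d := by positivity
  have hcover : (m + 1) ^ d * ((m + 1) ^ d).multichoose (n - 1) ≤ coveringNumberMod (Cube d)
      (MulAction.stabilizer (Equiv.Perm (Fin n)) (⟨0, hn⟩ : Fin n))
      (1 / (2 * (m : ℝ) * (2 * n * d + 1))) := by
    refine mul_multichoose_le_coveringNumberMod d hn hm (by positivity) ?_
    have h1 : (1 : ℝ) ≤ 2 * n * d + 1 := by linarith [(by positivity : (0 : ℝ) ≤ 2 * n * d)]
    rw [mul_one_div, div_le_div_iff₀ (by positivity) hm', one_mul]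
    nlinarith
  have hP : m + 1 ≤ (m + 1) ^ d * ((m + 1) ^ d).multichoose (n - 1) :=
    (Nat.le_self_pow hd.ne' _).trans (Nat.le_mul_of_pos_right _ (Nat.multichoose_pos hM _))
  obtain ⟨b, hb, hL⟩ := exists_block_length hn hm hP hcover
  obtain ⟨base, lab, hlab, hquant⟩ := exists_quantization hn hm hf
  set ω := modulusOfContinuity f (1 / (2 * m)) with hω
  let e : (Fin d → Fin (m + 1)) ≃ Fin ((m + 1) ^ d) := Fintype.equivFinOfCardEq (by simp)
  let center : Fin N → Fin ((m + 1) ^ d) → Cube d := fun q c a => gridCenter N m q (e.symm c a)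
  choose v hvle hv using fun q => exists_label hf (center q) lab hlab
  obtain ⟨Φ, hΦ, hΦval⟩ := exists_gridEncoder d N m fun κ => ((n : ℝ) + 1) ^ (e κ : ℕ)
  obtain ⟨ρ, hρ, hρval⟩ := exists_decoder (C := 33) (h := d * n) hn (by rw [hN]; ring) hM
    (Nat.size_pos.2 (by omega : 0 < 8 * m)) hb (by norm_num) v
    (fun q x => (hvle q x).trans_lt (Nat.lt_size_self _)) base (ω.toReal / 2)
  obtain ⟨B₁, B₂, h1, h2, h3, h4, h5, h6⟩ := exists_blocks hn hΦ hρ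
  rw [← hN]
  refine ⟨_, Φ, ρ, B₁, B₂, hΦ, hρ, ⟨_, rfl, ?_⟩, h1, h2, h3, h4, h5, fun X i => ⟨h6 X i, ?_⟩⟩
  -- The first term of the maximum alone bounds the depth.
  · exact hL.trans (by push_cast; gcongr; exact le_max_left _ _)
  rw [h6]
  rcases eq_or_ne ω ⊤ with htop | htop
  · rw [htop, ENNReal.mul_top (by norm_num)]
    exact le_top
  set w := ω.toReal with hw
  have hw0 : 0 ≤ w := ENNReal.toReal_nonneg
  let K : Fin N → Fin n → Fin ((m + 1) ^ d) := fun q j => e (cubeCell m q (X j))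
  let l : Fin N → ℕ := fun q => lab (f (center q ∘ K q) i)
  let G : Finset (Fin N) := Finset.univ.filter fun q => ∀ j a, AvoidsGaps N m q (X j a)
  have hgood : ∀ q ∈ G, ∀ j a, AvoidsGaps N m q (X j a) := fun q hq => (Finset.mem_filter.1 hq).2
  have hG : d * n < G.card := by
    have hcard : N ≤ n * d + G.card := card_avoidsGaps (by omega) m fun j a => X j a
    have hdn : N = 2 * (d * n) + 1 := by rw [hN]; ring
    rw [Nat.mul_comm n d] at hcard
    omega
  have hclose : ∀ q ∈ G, |f X i - f (center q ∘ K q) i| ≤ w := by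
    intro q hq
    refine abs_sub_le_modulus htop ?_ i
    refine (dist_pi_le_iff (by positivity)).2 fun j => (dist_pi_le_iff (by positivity)).2 fun a => ?_
    have hcell : (center q ∘ K q) j a = gridCenter N m q (gridCell N m q (X j a)) := by
      simp only [center, K, Function.comp_apply, Equiv.symm_apply_apply]
      rfl
    rw [hcell]
    exact dist_gridCenter_le q.2 hm (X j a) (hgood q hq j a)
  have hGne : G.Nonempty := Finset.card_pos.1 (by omega)
  obtain ⟨q₁, hq₁, hmin⟩ := Finset.exists_min_image G l hGne
  obtain ⟨q₂, hq₂, hmax⟩ := Finset.exists_max_image G l hGne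
  obtain ⟨a, ha₁, ha₂, ha⟩ := hρval K i
    (Sum.elim (Φ (point (X i))) (∑ j ∈ Finset.univ.erase i, Φ (point (X j)))) G (l q₁) (l q₂) hG
    (fun q hq => ⟨hΦval _ _ (hgood q hq i), by
      rw [Sum.elim_inr, Finset.sum_apply]
      exact Finset.sum_congr rfl fun j _ => hΦval _ _ (hgood q hq j)⟩)
    fun q hq => by rw [hv]; exact ⟨hmin q hq, hmax q hq⟩
  have hlow := (hquant htop (center q₁ ∘ K q₁) i).2
  have hupp := (hquant htop (center q₂ ∘ K q₂) i).1
  have hc₁ := abs_le.1 (hclose q₁ hq₁)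
  have hc₂ := abs_le.1 (hclose q₂ hq₂)
  change _ ≤ base + w / 2 * (l q₁ + 1) at hlow
  change base + w / 2 * l q₂ ≤ _ at hupp
  have hmul₁ : w / 2 * (l q₁ - 1) ≤ w / 2 * a := by gcongr
  have hmul₂ : w / 2 * a ≤ w / 2 * (l q₂ + 1) := by gcongr
  rw [ha, ← ENNReal.ofReal_toReal htop, ← hw, ← ENNReal.ofReal_ofNat 2,
    ← ENNReal.ofReal_mul (by norm_num)]
  -- From below, the smallest good label `l q₁` loses `w` to the centre and `w` to quantization and
  -- vote together. From above, quantization rounds down, so `l q₂` costs only `3w/2`.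
  refine ENNReal.ofReal_le_ofReal (abs_le.2 ⟨?_, ?_⟩) <;> linarith
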